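/- Let $T>0$, let $b\colon\mathbb{R}\to\mathbb{R}$ be continuous with $0\le b(x)\le C+C|x|$ for all $x\in\mathbb{R}$ and some number $C>0$, and let $Z=\{x\colon b(x)=0\}$. A locally bounded (possibly signed) Borel measure on $\mathbb{R}$ is a real function on the bounded Borel sets that is countably additive on the Borel subsets of every compact set; $|\mu|$ denotes the total variation of such a measure $\mu$. Let $\nu$ be a locally bounded Borel measure on $\mathbb{R}$. A solution to the Cauchy problem $$\partial_t\mu+{\rm div}(b\mu)=0,\qquad \mu|_{t=0}=\nu$$ on $[0,T]$ is a measure $\mu=\mu_t(dx)\,dt$ given by a family $(\mu_t)_{t\in[0,T]}$ of locally bounded Borel measures on $\mathbb{R}$ such that (a) $t\mapsto\mu_t(B)$ is measurable for every bounded Borel set $B$, and $t\mapsto|\mu_t|(K)$ belongs to $L^1[0,T]$ for every compact set $K$; (b) $\int_0^T\int_U |b|\,d|\mu_t|\,dt<\infty$ for every bounded open interval $U$; (c) for every function $u$ on $\mathbb{R}\times[0,T)$ that is continuous along with its first order derivatives in $t$ and $x$ and satisfies $u(x,t)=0$ whenever $|x|>R$ for some $R$, one has, for almost every $t\in[0,T]$,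 $$\int_{\mathbb{R}}u(x,t)\,\mu_t(dx)=\int_{\mathbb{R}}u(x,0)\,\nu(dx)+\int_0^t\int_{\mathbb{R}}\bigl[\partial_t u(x,s)+b(x)\,\partial_x u(x,s)\bigr]\,\mu_s(dx)\,ds .$$ Then the Cauchy problem has at most one solution in the class of families with $|\mu_t|(\partial Z)=0$ for almost every $t\in[0,T]$, where $\partial Z$ is the topological boundary of $Z$: any two solutions $(\mu^1_t)$ and $(\mu^2_t)$ in this class satisfy $\mu^1_t=\mu^2_t$ for almost every $t\in[0,T]$. In particular, if $Z=b^{-1}(0)$ has Lebesgue measure zero, then any two solutions $(\mu^1_t)$ and $(\mu^2_t)$ such that $\mu^1_t$ and $\mu^2_t$ are absolutely continuous with respect to Lebesgue measure for almost every $t\in[0,T]$ satisfy $\mu^1_t=\mu^2_t$ for almost every $t\in[0,T]$. -/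

import Mathlib

open MeasureTheory Set

/-- A locally bounded (possibly signed) Borel measure on the real line: a real function on the
bounded Borel sets which is countably additive on the Borel subsets of every compact set.
(The value at every other set is fixed to be `0`, so that equality of two such objects means
equality on all bounded Borel sets.) -/
structure LocBddMeasure where
  /-- the value at a set -/
  toFun : Set ℝ → ℝ
  /-- the fixed value outside the class of bounded Borel sets -/
  eq_zero_of_not : ∀ B : Set ℝ, ¬ (MeasurableSet B ∧ Bornology.IsBounded B) → toFun B = 0
  /-- countable additivity on the Borel subsets of a compact set -/
  hasSum_iUnion : ∀ K : Set ℝ, IsCompact K → ∀ f : ℕ → Set ℝ, (∀ i, MeasurableSet (f i)) →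
    (∀ i, f i ⊆ K) → Pairwise (fun i j => Disjoint (f i) (f j)) →
    HasSum (fun i => toFun (f i)) (toFun (⋃ i, f i))

namespace LocBddMeasure

/-- The empty set has measure zero. -/
theorem toFun_empty (μ : LocBddMeasure) : μ.toFun ∅ = 0 := by
  have h := μ.hasSum_iUnion ∅ isCompact_empty (fun _ => ∅) (by simp) (by simp)
    (fun _ _ _ => by simp)
  exact tendsto_nhds_unique tendsto_const_nhds h.summable.tendsto_atTop_zero

open Classical in
/-- The restriction `A ↦ μ (A ∩ (n, n + 1])`, a signed measure of finite total variation. -/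
noncomputable def piece (μ : LocBddMeasure) (n : ℤ) : SignedMeasure ℝ where
  measureOf' A := if MeasurableSet A then μ.toFun (A ∩ Ioc (n : ℝ) (n + 1)) else 0
  empty' := by simp [μ.toFun_empty]
  not_measurable' A hA := by simp [hA]
  m_iUnion' f hf hd := by
    have h := μ.hasSum_iUnion (Icc (n : ℝ) (n + 1)) isCompact_Icc
      (fun i => f i ∩ Ioc (n : ℝ) (n + 1)) (fun i => (hf i).inter measurableSet_Ioc)
      (fun i => inter_subset_right.trans Ioc_subset_Icc_self)
      (fun i j hij => (hd hij).mono inter_subset_left inter_subset_left)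
    simpa [hf, MeasurableSet.iUnion hf, iUnion_inter] using h

/-- The positive part `μ⁺` of the Hahn-Jordan decomposition, glued from the bounded pieces. -/
noncomputable def posPart (μ : LocBddMeasure) : Measure ℝ :=
  Measure.sum fun n : ℤ => (μ.piece n).toJordanDecomposition.posPart

/-- The negative part `μ⁻` of the Hahn-Jordan decomposition, glued from the bounded pieces. -/
noncomputable def negPart (μ : LocBddMeasure) : Measure ℝ :=
  Measure.sum fun n : ℤ => (μ.piece n).toJordanDecomposition.negPart

/-- The total variation `|μ| = μ⁺ + μ⁻`, a locally finite measure. -/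
noncomputable def totalVariation (μ : LocBddMeasure) : Measure ℝ := μ.posPart + μ.negPart

/-- The integral `∫ u dμ = ∫ u dμ⁺ - ∫ u dμ⁻`. -/
noncomputable def integral (μ : LocBddMeasure) (u : ℝ → ℝ) : ℝ :=
  ∫ x, u x ∂μ.posPart - ∫ x, u x ∂μ.negPart

end LocBddMeasure

/-- On the time interval `[0, T]`, the family `(μ t)` defines the locally bounded measure
`μ t (dx) dt`: `t ↦ μ t B` is (Lebesgue) measurable on `[0, T]` for each bounded Borel set `B`, and
`t ↦ |μ t| K` is in `L¹[0, T]` for each compact set `K`. -/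
structure IsLocBddFamily (T : ℝ) (μ : ℝ → LocBddMeasure) : Prop where
  aemeasurable : ∀ B : Set ℝ, MeasurableSet B → Bornology.IsBounded B →
    AEMeasurable (fun t => (μ t).toFun B) (volume.restrict (Icc 0 T))
  integrableOn : ∀ K : Set ℝ, IsCompact K →
    IntegrableOn (fun t => ((μ t).totalVariation K).toReal) (Icc 0 T) volume

/-- `u` is of class `C^{1,1}` on `ℝ × [0, T)` with partial derivatives `ut` (in time) and
`ux` (in space), all three continuous, and `u (x, t) = 0` if `|x| > R` for some `R`. -/
structure IsTestFunction (T : ℝ) (u ut ux : ℝ → ℝ → ℝ) : Prop where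
  continuousOn : ContinuousOn (fun p : ℝ × ℝ => u p.1 p.2) (univ ×ˢ Ico 0 T)
  continuousOn_ut : ContinuousOn (fun p : ℝ × ℝ => ut p.1 p.2) (univ ×ˢ Ico 0 T)
  continuousOn_ux : ContinuousOn (fun p : ℝ × ℝ => ux p.1 p.2) (univ ×ˢ Ico 0 T)
  hasDerivWithinAt_ut : ∀ x, ∀ t ∈ Ico 0 T,
    HasDerivWithinAt (fun s => u x s) (ut x t) (Ico 0 T) t
  hasDerivAt_ux : ∀ x, ∀ t ∈ Ico 0 T, HasDerivAt (fun y => u y t) (ux x t) x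
  eq_zero : ∃ R : ℝ, ∀ x, R < |x| → ∀ t ∈ Ico 0 T, u x t = 0

/-- The measure `μ t (dx) dt` on `ℝ × [0, T]` solves the Cauchy problem
`∂ₜ μ + div (b μ) = 0`, `μ|_{t = 0} = ν`. -/
structure IsSolution (T : ℝ) (b : ℝ → ℝ) (ν : LocBddMeasure) (μ : ℝ → LocBddMeasure) : Prop where
  isLocBddFamily : IsLocBddFamily T μ
  /-- `b` is in `L¹(|μ t|(dx) dt, U × [0, T])` for every ball `U` -/
  integrable : ∀ R : ℝ,
    ∫⁻ t in Icc 0 T, ∫⁻ x in Metric.ball 0 R, ‖b x‖ₑ ∂(μ t).totalVariation < ⊤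
  weak_eq : ∀ u ut ux : ℝ → ℝ → ℝ, IsTestFunction T u ut ux →
    ∀ᵐ t ∂(volume.restrict (Icc 0 T)),
      (μ t).integral (fun x => u x t) = ν.integral (fun x => u x 0) +
        ∫ s in (0 : ℝ)..t, (μ s).integral (fun x => ut x s + b x * ux x s)

/-! Let σ be the difference of two solutions, σ¹ its time integral over (0, t], σ² the time integral
of σ¹, and F(·, t) the distribution function of σ¹. Integrating the weak equation once in time makes
it valid for every t: ∫ u dσ¹ = ∫ b u' dσ². Integration by parts on the left gives b σ² = G dz with
G(z, t) = c(t) - F(z, t) (`integral_mul_fluxDensity`).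

Off Z this says that σ² has density G / b. On Z, σ¹ vanishes: in the interior because there b u' = 0
for every test function u supported in it (`primitive_open_eq`), on ∂Z by assumption
(`primitive_inter_zeros_eq`). This is the only use of the condition on ∂Z. Hence σ² = (G / b) dz
everywhere, and G = 0 a.e. on Z. For Γ(z, t) = ∫₀ᵗ G(z, s) ds this reads Γ(y, t) - Γ(x, t) = -σ²((x,
y]) = -∫ₓʸ G / b, that is b ∂ₓΓ = -∂ₜΓ, with Γ of class C¹ in t and absolutely continuous in x
(`IsNullSolution.isFluxDensity`).

The equation for Γ is solved with x as the evolution variable. The energy E(z) = ∫₀ᵀ exp(-lt) Γ² dt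
satisfies b E' = -exp(-lT) Γ(z, T)² - l E, so E' ≤ -l E / (C + C|z|): it is nonincreasing, and
Gronwall's inequality on the negative half-line compares E(y) with E(x) for x far to the left
(`energy_exp_decay`). When x is so far away that a particle of speed at most C + C|z| needs time T +
1 to travel from x to y, the gain exp(-l(T + 1)) beats the loss exp(-lT) from the weight, and l → ∞
gives Γ(y, ·) = 0 (`energy_zero_eq_zero`). Monotonicity extends this to all y. Then G = ∂ₜΓ = 0, F
is constant in z, σ¹ = 0, and differentiation in time gives σ = 0 for almost every t.

Signed measures are handled throughout as pairs of positive ones, p = P₁ + Q₂ and q = Q₁ + P₂, where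
P and Q are the Jordan parts. -/

/-! ### The energy method in the space variable -/

/-- The square of the primitive of an integrable function, by the chain rule. -/
theorem sq_sub_sq_eq_integral {f q : ℝ → ℝ} {x y : ℝ} (hxy : x ≤ y)
    (hq : IntervalIntegrable q volume x y)
    (hf : ∀ z ∈ Icc x y, f z - f x = -∫ r in x..z, q r) :
    f y ^ 2 - f x ^ 2 = -∫ z in x..y, 2 * f z * q z := by
  set F : ℝ → ℝ := fun z => ∫ r in x..z, q r with hF
  have hac : AbsolutelyContinuousOnInterval F x y :=
    hq.absolutelyContinuousOnInterval_intervalIntegral (by simp)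
  have h1 := hac.integral_deriv_mul_eq_sub hac
  have hFx : F x = 0 := by simp [hF]
  have hd : ∀ᵐ z, z ∈ uIoc x y → deriv F z * F z + F z * deriv F z = 2 * F z * q z := by
    filter_upwards [hq.ae_hasDerivAt_integral] with z hz hzm
    have := (hz (uIoc_subset_uIcc hzm) x (by simp)).deriv
    rw [show deriv F z = q z from this]; ring
  rw [intervalIntegral.integral_congr_ae hd, hFx] at h1
  have hFq : IntervalIntegrable (fun z => 2 * F z * q z) volume x y :=
    hq.continuousOn_mul (hac.continuousOn.const_mul 2 |>.congr fun z _ => by simp)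
  have h2 : ∫ z in x..y, 2 * f z * q z = ∫ z in x..y, (2 * f x * q z - 2 * F z * q z) := by
    refine intervalIntegral.integral_congr fun z hz => ?_
    rw [uIcc_of_le hxy] at hz
    have := hf z hz
    simp only [hF]
    linear_combination (2 * q z) * this
  rw [h2, intervalIntegral.integral_sub (hq.const_mul _) hFq, intervalIntegral.integral_const_mul,
    h1]
  have := hf y ⟨hxy, le_rfl⟩
  have e : f y = f x - F y := by simp only [hF]; linarith
  change _ = -(2 * f x * F y - _)
  rw [e]; ring

/-- The estimates for a function `G (x, t)` whose integral `Γ` over `[0, t]` is locally absolutely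
continuous in `x` and satisfies `b ∂ₓ Γ = - ∂ₜ Γ`. -/
structure IsFluxDensity (T C : ℝ) (b : ℝ → ℝ) (G : ℝ → ℝ → ℝ) : Prop where
  T_pos : 0 < T
  C_pos : 0 < C
  continuous_b : Continuous b
  b_bound : ∀ x, 0 ≤ b x ∧ b x ≤ C + C * |x|
  continuous_time : ∀ z, Continuous (G z)
  measurable_space : ∀ t, Measurable fun z => G z t
  bound : ∀ N : ℝ, ∃ M, ∀ z, |z| ≤ N → ∀ t ∈ Icc 0 T, |G z t| ≤ M
  eq_zero : ∀ t ∈ Icc 0 T, ∀ᵐ z, b z = 0 → G z t = 0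
  integrable_div : ∀ x y, ∃ M, ∀ t ∈ Icc 0 T, IntegrableOn (fun z => G z t / b z) (Ioc x y) ∧
    ∫ z in Ioc x y, |G z t / b z| ≤ M
  integral_sub : ∀ t ∈ Icc 0 T, ∀ x y, x ≤ y →
    (∫ s in (0 : ℝ)..t, G y s) - ∫ s in (0 : ℝ)..t, G x s = -∫ z in x..y, G z t / b z

namespace IsFluxDensity

variable {T C : ℝ} {b : ℝ → ℝ} {G : ℝ → ℝ → ℝ}

theorem measurable_uncurry (h : IsFluxDensity T C b G) : Measurable fun p : ℝ × ℝ => G p.2 p.1 :=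
  measurable_uncurry_of_continuous_of_measurable (u := fun t z => G z t) h.continuous_time
    h.measurable_space

/-- The integral over `[0, t]`. -/
noncomputable def timeIntegral (G : ℝ → ℝ → ℝ) (z t : ℝ) : ℝ := ∫ s in (0 : ℝ)..t, G z s

theorem hasDerivAt_timeIntegral (h : IsFluxDensity T C b G) (z t : ℝ) :
    HasDerivAt (timeIntegral G z) (G z t) t :=
  (h.continuous_time z).integral_hasStrictDerivAt 0 t |>.hasDerivAt

theorem continuous_timeIntegral (h : IsFluxDensity T C b G) (z : ℝ) :
    Continuous (timeIntegral G z) :=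
  continuous_iff_continuousAt.2 fun t => (h.hasDerivAt_timeIntegral z t).continuousAt

theorem measurable_timeIntegral (h : IsFluxDensity T C b G) (t : ℝ) :
    Measurable fun z => timeIntegral G z t := by
  have hs : StronglyMeasurable (fun p : ℝ × ℝ => G p.1 p.2) :=
    (h.measurable_uncurry.comp measurable_swap).stronglyMeasurable
  unfold timeIntegral intervalIntegral
  exact (hs.integral_prod_right.sub hs.integral_prod_right).measurable

theorem measurable_uncurry_timeIntegral (h : IsFluxDensity T C b G) :
    Measurable fun p : ℝ × ℝ => timeIntegral G p.2 p.1 :=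
  measurable_uncurry_of_continuous_of_measurable (u := fun t z => timeIntegral G z t)
    h.continuous_timeIntegral h.measurable_timeIntegral

theorem timeIntegral_bound (h : IsFluxDensity T C b G) (N : ℝ) :
    ∃ M, ∀ z, |z| ≤ N → ∀ t ∈ Icc 0 T, |timeIntegral G z t| ≤ M := by
  obtain ⟨M, hM⟩ := h.bound N
  refine ⟨M * T, fun z hz t ht => ?_⟩
  have h1 := intervalIntegral.norm_integral_le_of_norm_le_const (a := 0) (b := t) (C := M)
    (f := G z) fun s hs => by
      rw [uIoc_of_le ht.1] at hs
      exact hM z hz s ⟨hs.1.le, hs.2.trans ht.2⟩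
  have hM0 : 0 ≤ M := (abs_nonneg _).trans (hM z hz t ht)
  refine h1.trans ?_
  rw [sub_zero, abs_of_nonneg ht.1]
  exact mul_le_mul_of_nonneg_left ht.2 hM0

/-- The weighted energy at the point `z`. -/
noncomputable def energy (G : ℝ → ℝ → ℝ) (T l z : ℝ) : ℝ :=
  ∫ t in (0 : ℝ)..T, Real.exp (-(l * t)) * timeIntegral G z t ^ 2

/-- The weighted integral of the time derivative of the squared time integral. -/
noncomputable def energyFlux (G : ℝ → ℝ → ℝ) (T l z : ℝ) : ℝ :=
  ∫ t in (0 : ℝ)..T, Real.exp (-(l * t)) * (2 * timeIntegral G z t * G z t)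

/-- Integration by parts in time; the boundary term at 0 drops out because the time integral starts
there. -/
theorem energyFlux_eq (h : IsFluxDensity T C b G) (l z : ℝ) :
    energyFlux G T l z =
      Real.exp (-(l * T)) * timeIntegral G z T ^ 2 + l * energy G T l z := by
  have hc := h.continuous_timeIntegral z
  have hG := h.continuous_time z
  have hd : ∀ t ∈ uIcc 0 T, HasDerivAt (fun t => Real.exp (-(l * t)) * timeIntegral G z t ^ 2)
      (Real.exp (-(l * t)) * (2 * timeIntegral G z t * G z t) -
        l * (Real.exp (-(l * t)) * timeIntegral G z t ^ 2)) t := by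
    intro t _
    have h1 : HasDerivAt (fun t : ℝ => -(l * t)) (-(l * 1)) t := ((hasDerivAt_id t).const_mul l).neg
    have h2 := h1.exp.mul ((h.hasDerivAt_timeIntegral z t).pow 2)
    refine h2.congr_deriv ?_
    simp; ring
  have hi := intervalIntegral.integral_eq_sub_of_hasDerivAt hd
    (Continuous.intervalIntegrable (by fun_prop) _ _)
  rw [intervalIntegral.integral_sub (Continuous.intervalIntegrable (by fun_prop) _ _)
    (Continuous.intervalIntegrable (by fun_prop) _ _), intervalIntegral.integral_const_mul] at hi
  have h0 : timeIntegral G z 0 = 0 := by simp [timeIntegral]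
  rw [h0] at hi
  unfold energyFlux energy
  linarith

theorem energy_nonneg (h : IsFluxDensity T C b G) (l z : ℝ) : 0 ≤ energy G T l z :=
  intervalIntegral.integral_nonneg h.T_pos.le fun t _ => by positivity

/-- The hypothesis of Fubini's theorem for `energy_sub`: Γ is bounded on the strip and G / b has a
spatial L¹ norm bounded uniformly in time. -/
theorem integrable_energy_prod (h : IsFluxDensity T C b G) {l : ℝ} (hl : 0 ≤ l) (x y : ℝ) :
    Integrable (fun p : ℝ × ℝ => Real.exp (-(l * p.1)) *
      (2 * timeIntegral G p.2 p.1 * (G p.2 p.1 / b p.2)))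
      ((volume.restrict (Ioc 0 T)).prod (volume.restrict (Ioc x y))) := by
  have hb := h.continuous_b.measurable
  have h1 := h.measurable_uncurry
  have h2 := h.measurable_uncurry_timeIntegral
  have hm : Measurable (fun p : ℝ × ℝ => Real.exp (-(l * p.1)) *
      (2 * timeIntegral G p.2 p.1 * (G p.2 p.1 / b p.2))) :=
    (by fun_prop : Measurable fun p : ℝ × ℝ => Real.exp (-(l * p.1))).mul
      ((h2.const_mul 2).mul (h1.div (hb.comp measurable_snd)))
  obtain ⟨A, hA⟩ := h.timeIntegral_bound (max |x| |y|)
  obtain ⟨M, hM⟩ := h.integrable_div x y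
  have hzN : ∀ z ∈ Ioc x y, |z| ≤ max |x| |y| := fun z hz =>
    abs_le_max_abs_abs hz.1.le hz.2
  have hbd : ∀ t ∈ Icc 0 T, ∀ z ∈ Ioc x y, ‖Real.exp (-(l * t)) *
      (2 * timeIntegral G z t * (G z t / b z))‖ ≤ 2 * A * |G z t / b z| := by
    intro t ht z hz
    rw [norm_mul, norm_mul, norm_mul, Real.norm_of_nonneg (Real.exp_pos _).le]
    have e1 : Real.exp (-(l * t)) ≤ 1 := Real.exp_le_one_iff.2 (by nlinarith [ht.1])
    have e2 := hA z (hzN z hz) t ht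
    have e3 := abs_nonneg (timeIntegral G z t)
    have e4 := abs_nonneg (G z t / b z)
    simp only [Real.norm_eq_abs, abs_two]
    calc _ ≤ 1 * (2 * A * |G z t / b z|) := by gcongr
      _ = _ := one_mul _
  have hint : ∀ t ∈ Icc 0 T, IntegrableOn (fun z => Real.exp (-(l * t)) *
      (2 * timeIntegral G z t * (G z t / b z))) (Ioc x y) := by
    intro t ht
    refine Integrable.mono' (g := fun z => 2 * A * |G z t / b z|)
      ((hM t ht).1.abs.const_mul (2 * A))
      (hm.comp (measurable_const.prodMk measurable_id)).aestronglyMeasurable ?_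
    exact (ae_restrict_iff' measurableSet_Ioc).2 (ae_of_all _ fun z hz => hbd t ht z hz)
  rw [integrable_prod_iff hm.aestronglyMeasurable]
  constructor
  · exact (ae_restrict_iff' measurableSet_Ioc).2 (ae_of_all _ fun t ht =>
      hint t ⟨ht.1.le, ht.2⟩)
  · refine Integrable.mono' (g := fun _ => 2 * |A| * M) (integrable_const _)
      hm.aestronglyMeasurable.norm.integral_prod_right' ?_
    refine (ae_restrict_iff' measurableSet_Ioc).2 (ae_of_all _ fun t ht => ?_)
    have ht' : t ∈ Icc 0 T := ⟨ht.1.le, ht.2⟩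
    rw [Real.norm_of_nonneg (integral_nonneg fun _ => norm_nonneg _)]
    calc _ ≤ ∫ z in Ioc x y, 2 * |A| * |G z t / b z| := by
          refine setIntegral_mono_on (hint t ht').norm ((hM t ht').1.abs.const_mul _)
            measurableSet_Ioc fun z hz => (hbd t ht' z hz).trans ?_
          gcongr; exact le_abs_self A
      _ = 2 * |A| * ∫ z in Ioc x y, |G z t / b z| := integral_const_mul _ _
      _ ≤ _ := by gcongr; exact (hM t ht').2

theorem energyFlux_div (z l : ℝ) (h : 0 < T) : energyFlux G T l z / b z =
    ∫ t in Ioc 0 T, Real.exp (-(l * t)) * (2 * timeIntegral G z t * (G z t / b z)) := by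
  rw [energyFlux, intervalIntegral.integral_of_le h.le, ← integral_div]
  refine integral_congr_ae (ae_of_all _ fun t => ?_)
  dsimp only; ring

theorem intervalIntegrable_energyFlux_div (h : IsFluxDensity T C b G) {l : ℝ} (hl : 0 ≤ l)
    (x y : ℝ) : IntervalIntegrable (fun z => energyFlux G T l z / b z) volume x y := by
  simp_rw [energyFlux_div _ l h.T_pos]
  exact ⟨(h.integrable_energy_prod hl x y).integral_prod_right,
    (h.integrable_energy_prod hl y x).integral_prod_right⟩

/-- The chain rule for Γ² at each fixed time, then Fubini. This is the integrated form of b E' =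
-(energy flux). -/
theorem energy_sub (h : IsFluxDensity T C b G) {l : ℝ} (hl : 0 ≤ l) {x y : ℝ} (hxy : x ≤ y) :
    energy G T l y - energy G T l x = -∫ z in x..y, energyFlux G T l z / b z := by
  have hc : ∀ z, Continuous fun t => Real.exp (-(l * t)) * timeIntegral G z t ^ 2 := fun z => by
    have := h.continuous_timeIntegral z
    fun_prop
  simp_rw [energyFlux_div _ l h.T_pos]
  rw [energy, energy, ← intervalIntegral.integral_sub ((hc y).intervalIntegrable _ _)
    ((hc x).intervalIntegrable _ _), intervalIntegral.integral_of_le h.T_pos.le,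
    intervalIntegral.integral_of_le hxy, ← integral_integral_swap (h.integrable_energy_prod hl x y),
    ← integral_neg]
  refine setIntegral_congr_fun measurableSet_Ioc fun t ht => ?_
  have ht' : t ∈ Icc 0 T := ⟨ht.1.le, ht.2⟩
  obtain ⟨M, hM⟩ := h.integrable_div x y
  have := sq_sub_sq_eq_integral (f := fun z => timeIntegral G z t) hxy
    ((intervalIntegrable_iff_integrableOn_Ioc_of_le hxy).2 (hM t ht').1)
    fun z hz => h.integral_sub t ht' x z hz.1
  rw [integral_const_mul, ← mul_sub, this, intervalIntegral.integral_of_le hxy, mul_neg]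

/-- The exceptional null set in the hypothesis depends on t. Rational times and continuity in t give
one null set for all times. -/
theorem ae_eq_zero (h : IsFluxDensity T C b G) :
    ∀ᵐ z, b z = 0 → ∀ t ∈ Icc 0 T, timeIntegral G z t = 0 := by
  have h1 : ∀ᵐ z, ∀ q : ℚ, (q : ℝ) ∈ Icc 0 T → b z = 0 → G z q = 0 := by
    rw [ae_all_iff]; intro q
    by_cases hq : (q : ℝ) ∈ Icc 0 T
    · filter_upwards [h.eq_zero q hq] with z hz _ hb using hz hb
    · exact ae_of_all _ fun z hz => absurd hz hq
  filter_upwards [h1] with z hz hbz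
  have hG : ∀ t ∈ Ioo 0 T, G z t = 0 := by
    have hd : Dense (range ((↑) : ℚ → ℝ)) := Rat.denseRange_cast
    intro t ht
    have hcl : t ∈ closure (Ioo 0 T ∩ range ((↑) : ℚ → ℝ)) := hd.open_subset_closure_inter
      isOpen_Ioo ht
    have hz0 : IsClosed {t | G z t = 0} := isClosed_eq (h.continuous_time z) continuous_const
    refine hz0.closure_subset_iff.2 ?_ hcl
    rintro _ ⟨hq, q, rfl⟩
    exact hz q (Ioo_subset_Icc_self hq) hbz
  intro t ht
  rw [timeIntegral, intervalIntegral.integral_of_le ht.1, integral_Ioc_eq_integral_Ioo]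
  exact setIntegral_eq_zero_of_forall_eq_zero fun s hs => hG s ⟨hs.1, hs.2.trans_le ht.2⟩

theorem continuous_energy (h : IsFluxDensity T C b G) {l : ℝ} (hl : 0 ≤ l) :
    Continuous (energy G T l) := by
  have h1 : ∀ z, energy G T l z =
      energy G T l 0 - ∫ r in (0 : ℝ)..z, energyFlux G T l r / b r := by
    intro z
    rcases le_total 0 z with hz | hz
    · linarith [h.energy_sub hl hz]
    · rw [intervalIntegral.integral_symm]; linarith [h.energy_sub hl hz]
  rw [show energy G T l = _ from funext h1]
  exact continuous_const.sub
    (intervalIntegral.continuous_primitive (h.intervalIntegrable_energyFlux_div hl) 0)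

/-- The flux is at least l E, since the term at time T is a square, and b ≤ C + C|z| bounds 1 / b
from below. At almost every zero of b the energy itself is 0, so the quotient with value 0 there
does no harm. -/
theorem energy_decay (h : IsFluxDensity T C b G) {l : ℝ} (hl : 0 ≤ l) {x y : ℝ} (hxy : x ≤ y) :
    energy G T l y + l * ∫ z in x..y, energy G T l z / (C + C * |z|) ≤ energy G T l x := by
  have hc : ∀ z : ℝ, 0 < C + C * |z| := fun z => by
    have := h.C_pos
    positivity
  have hE : Continuous fun z => energy G T l z / (C + C * |z|) :=
    (h.continuous_energy hl).div (by fun_prop) fun z => (hc z).ne'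
  have h1 := h.energy_sub hl hxy
  have h2 : ∫ z in x..y, l * (energy G T l z / (C + C * |z|)) ≤
      ∫ z in x..y, energyFlux G T l z / b z := by
    refine intervalIntegral.integral_mono_ae hxy ((hE.intervalIntegrable _ _).const_mul _)
      (h.intervalIntegrable_energyFlux_div hl x y) ?_
    filter_upwards [h.ae_eq_zero] with z hz
    have hn := h.energy_nonneg l z
    rcases (h.b_bound z).1.eq_or_lt with hb | hb
    · have : energy G T l z = 0 := by
        rw [energy, intervalIntegral.integral_of_le h.T_pos.le]
        refine setIntegral_eq_zero_of_forall_eq_zero fun t ht => ?_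
        rw [hz hb.symm t ⟨ht.1.le, ht.2⟩]; ring
      rw [this, ← hb]; simp
    · rw [h.energyFlux_eq, ← mul_div_assoc]
      have : 0 ≤ Real.exp (-(l * T)) * timeIntegral G z T ^ 2 := by positivity
      exact div_le_div₀ (by positivity) (by linarith) hb (h.b_bound z).2
  rw [intervalIntegral.integral_const_mul] at h2
  linarith

theorem energy_antitone (h : IsFluxDensity T C b G) {l : ℝ} (hl : 0 ≤ l) :
    Antitone (energy G T l) := fun x y hxy => by
  have h1 := h.energy_decay hl hxy
  have h2 : 0 ≤ ∫ z in x..y, energy G T l z / (C + C * |z|) :=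
    intervalIntegral.integral_nonneg hxy fun z _ => by
      have := h.energy_nonneg l z
      have := h.C_pos
      positivity
  nlinarith

/-- Exponential decay of the energy to the right, on the negative half-line. -/
theorem energy_exp_decay (h : IsFluxDensity T C b G) {l : ℝ} (hl : 0 ≤ l) {x y : ℝ} (hxy : x ≤ y)
    (hy : y ≤ 0) :
    energy G T l y * Real.exp (-(l * (Real.log (1 - y) / C))) ≤
      energy G T l x * Real.exp (-(l * (Real.log (1 - x) / C))) := by
  have hC := h.C_pos
  have hc : ∀ z : ℝ, 0 < C + C * |z| := fun z => by positivity
  have hE : Continuous fun z => energy G T l z / (C + C * |z|) :=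
    (h.continuous_energy hl).div (by fun_prop) fun z => (hc z).ne'
  -- The usual Gronwall majorization: A is differentiable, A(y) = E(y), and `energy_decay` gives A ≤
  -- E to the left of y. The exponential is the integrating factor, since log(1 - z) / C has
  -- derivative -1 / (C + C|z|) for z ≤ 0.
  set A : ℝ → ℝ := fun z => energy G T l y + l * ∫ r in z..y, energy G T l r / (C + C * |r|)
    with hA
  have hd : ∀ z ∈ Iic y, HasDerivAt
      (fun z => A z * Real.exp (-(l * (Real.log (1 - z) / C))))
      (-(l * (energy G T l z / (C + C * |z|))) * Real.exp (-(l * (Real.log (1 - z) / C))) +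
        A z * (Real.exp (-(l * (Real.log (1 - z) / C))) * (l / (C + C * |z|)))) z := by
    intro z hz
    have hz0 : z ≤ 0 := le_trans hz hy
    have h1 : HasDerivAt A (-(l * (energy G T l z / (C + C * |z|)))) z := by
      have := intervalIntegral.integral_hasDerivAt_left (hE.intervalIntegrable z y)
        (hE.stronglyMeasurableAtFilter _ _) hE.continuousAt
      exact ((this.const_mul l).const_add _).congr_deriv (by ring)
    have h2 : HasDerivAt (fun z : ℝ => -(l * (Real.log (1 - z) / C))) (l / (C + C * |z|)) z := by
      have h3 := ((hasDerivAt_id z).const_sub 1).log (by simp; linarith)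
      refine ((h3.div_const C).const_mul l).neg.congr_deriv ?_
      have : (1 - z) ≠ 0 := by linarith
      rw [abs_of_nonpos hz0]
      simp only [id]
      rw [show C + C * -z = C * (1 - z) by ring]
      field_simp
    exact h1.mul h2.exp
  have hanti : AntitoneOn (fun z => A z * Real.exp (-(l * (Real.log (1 - z) / C)))) (Iic y) := by
    refine antitoneOn_of_deriv_nonpos (convex_Iic y)
      (fun z hz => (hd z hz).continuousAt.continuousWithinAt)
      (fun z hz => (hd z (interior_subset hz)).differentiableAt.differentiableWithinAt)
      fun z hz => ?_
    have hz := interior_subset hz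
    rw [(hd z hz).deriv]
    have h1 : A z ≤ energy G T l z := h.energy_decay hl hz
    have h2 : 0 ≤ Real.exp (-(l * (Real.log (1 - z) / C))) * (l / (C + C * |z|)) := by
      have := hc z
      positivity
    have := mul_le_mul_of_nonneg_right h1 h2
    calc _ = (A z - energy G T l z) *
          (Real.exp (-(l * (Real.log (1 - z) / C))) * (l / (C + C * |z|))) := by ring
      _ ≤ 0 := by linarith
  have h1 := hanti hxy (mem_Iic.2 le_rfl) hxy
  have h2 : A y = energy G T l y := by simp [hA]
  dsimp only at h1
  rw [h2] at h1
  exact h1.trans (mul_le_mul_of_nonneg_right (h.energy_decay hl hxy) (Real.exp_pos _).le)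

theorem energy_zero_eq_zero (h : IsFluxDensity T C b G) {y : ℝ} (hy : y ≤ 0) :
    energy G T 0 y = 0 := by
  have hC := h.C_pos
  have hT := h.T_pos
  -- Chosen so that log(1 - x) / C exceeds log(1 - y) / C by T + 1, which is the travel time from x
  -- to y at speed C + C|z|.
  set x : ℝ := 1 - (1 - y) * Real.exp (C * (T + 1)) with hx
  have hxy : x ≤ y := by
    have : 1 ≤ Real.exp (C * (T + 1)) := Real.one_le_exp (by positivity)
    nlinarith
  have hlog : Real.log (1 - x) / C = Real.log (1 - y) / C + (T + 1) := by
    rw [hx, sub_sub_cancel, Real.log_mul (by linarith) (Real.exp_pos _).ne', Real.log_exp]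
    field_simp
  have hcont : ∀ l z, IntervalIntegrable
      (fun t => Real.exp (-(l * t)) * timeIntegral G z t ^ 2) volume 0 T := fun l z => by
    have := h.continuous_timeIntegral z
    exact Continuous.intervalIntegrable (by fun_prop) _ _
  have key : ∀ l : ℝ, 0 ≤ l → energy G T 0 y ≤ energy G T 0 x * Real.exp (-l) := by
    intro l hl
    have h1 := h.energy_exp_decay hl hxy hy
    rw [hlog, show -(l * (Real.log (1 - y) / C + (T + 1))) =
      -l + -(l * T) + -(l * (Real.log (1 - y) / C)) by ring, Real.exp_add, ← mul_assoc] at h1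
    have h2 := le_of_mul_le_mul_right h1 (Real.exp_pos _)
    have h3 : energy G T l x ≤ energy G T 0 x := by
      refine intervalIntegral.integral_mono_on hT.le (hcont _ _) (hcont _ _) fun t ht => ?_
      have : 0 ≤ l * t := mul_nonneg hl ht.1
      exact mul_le_mul_of_nonneg_right (Real.exp_le_exp.2 (by linarith)) (sq_nonneg _)
    have h4 : Real.exp (-(l * T)) * energy G T 0 y ≤ energy G T l y := by
      rw [energy, ← intervalIntegral.integral_const_mul]
      refine intervalIntegral.integral_mono_on hT.le ((hcont _ _).const_mul _) (hcont _ _)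
        fun t ht => ?_
      rw [← mul_assoc, ← Real.exp_add]
      have : l * t ≤ l * T := mul_le_mul_of_nonneg_left ht.2 hl
      exact mul_le_mul_of_nonneg_right (Real.exp_le_exp.2 (by linarith)) (sq_nonneg _)
    have h5 : Real.exp (-(l * T)) * energy G T 0 y ≤
        Real.exp (-(l * T)) * (energy G T 0 x * Real.exp (-l)) :=
      calc _ ≤ energy G T l x * Real.exp (-l + -(l * T)) := h4.trans h2
        _ ≤ energy G T 0 x * Real.exp (-l + -(l * T)) := by gcongr
        _ = _ := by rw [Real.exp_add]; ring
    exact le_of_mul_le_mul_left h5 (Real.exp_pos _)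
  have hlim : Filter.Tendsto (fun l : ℝ => energy G T 0 x * Real.exp (-l)) Filter.atTop
      (nhds (energy G T 0 x * 0)) :=
    (Real.tendsto_exp_neg_atTop_nhds_zero).const_mul _
  rw [mul_zero] at hlim
  refine le_antisymm (ge_of_tendsto hlim ?_) (h.energy_nonneg 0 y)
  filter_upwards [Filter.eventually_ge_atTop 0] with l hl using key l hl

/-- A flux density vanishes: finite speed of propagation from `-∞`. -/
theorem eq_zero_of_mem (h : IsFluxDensity T C b G) (z : ℝ) {t : ℝ} (ht : t ∈ Icc 0 T) :
    G z t = 0 := by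
  have hT := h.T_pos
  have hE : energy G T 0 z = 0 := by
    rcases le_total z 0 with hz | hz
    · exact h.energy_zero_eq_zero hz
    · exact le_antisymm ((h.energy_antitone le_rfl hz).trans_eq (h.energy_zero_eq_zero le_rfl))
        (h.energy_nonneg 0 z)
  have hc := h.continuous_timeIntegral z
  have hΓ : ∀ s ∈ Icc 0 T, timeIntegral G z s = 0 := by
    by_contra hne
    push Not at hne
    obtain ⟨s, hs, hs0⟩ := hne
    have := intervalIntegral.integral_pos (f := fun t => Real.exp (-(0 * t)) * timeIntegral G z t ^ 2)
      hT (by fun_prop) (fun t _ => by positivity) ⟨s, hs, by positivity⟩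
    rw [energy] at hE
    linarith
  have hG : ∀ s ∈ Ioo 0 T, G z s = 0 := by
    intro s hs
    have h1 : timeIntegral G z =ᶠ[nhds s] fun _ => 0 := by
      filter_upwards [Ioo_mem_nhds hs.1 hs.2] with r hr using hΓ r (Ioo_subset_Icc_self hr)
    exact (h.hasDerivAt_timeIntegral z s).unique ((hasDerivAt_const s 0).congr_of_eventuallyEq h1)
  -- Differentiation of Γ = 0 works only at interior times; the endpoints follow by continuity of G.
  have hz0 : IsClosed {t | G z t = 0} := isClosed_eq (h.continuous_time z) continuous_const
  rw [← closure_Ioo hT.ne] at ht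
  exact hz0.closure_subset_iff.2 hG ht

end IsFluxDensity

/-! ### Jordan parts of locally bounded measures -/

namespace LocBddMeasure

variable (μ : LocBddMeasure)

open Classical in
theorem piece_apply (n : ℤ) {A : Set ℝ} (hA : MeasurableSet A) :
    μ.piece n A = μ.toFun (A ∩ Ioc (n : ℝ) (n + 1)) := by
  change (if MeasurableSet A then μ.toFun (A ∩ Ioc (n : ℝ) (n + 1)) else 0) = _
  rw [if_pos hA]

theorem piece_apply_of_disjoint (n : ℤ) {A : Set ℝ} (hA : MeasurableSet A)
    (hd : Disjoint A (Ioc (n : ℝ) (n + 1))) : μ.piece n A = 0 := by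
  rw [μ.piece_apply n hA, hd.inter_eq, μ.toFun_empty]

/-- With this, only finitely many terms of the glued Jordan parts contribute on a bounded set, which
makes them finite there. -/
theorem piece_jordan_eq_zero (n : ℤ) {A : Set ℝ} (hA : MeasurableSet A)
    (hd : Disjoint A (Ioc (n : ℝ) (n + 1))) :
    (μ.piece n).toJordanDecomposition.posPart A = 0 ∧
      (μ.piece n).toJordanDecomposition.negPart A = 0 := by
  obtain ⟨i, hi₁, hi₂, hi₃, hp, hn⟩ := (μ.piece n).toJordanDecomposition_spec
  rw [hp, hn, SignedMeasure.toMeasureOfZeroLE_apply _ hi₂ hi₁ hA,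
    SignedMeasure.toMeasureOfLEZero_apply _ hi₃ hi₁.compl hA]
  have h1 := μ.piece_apply_of_disjoint n (hi₁.inter hA) (hd.mono_left inter_subset_right)
  have h2 := μ.piece_apply_of_disjoint n (hi₁.compl.inter hA) (hd.mono_left inter_subset_right)
  constructor <;> simp [h1, h2]

theorem exists_finset_disjoint {B : Set ℝ} (hB : Bornology.IsBounded B) :
    ∃ F : Finset ℤ, ∀ n ∉ F, Disjoint B (Ioc (n : ℝ) (n + 1)) := by
  obtain ⟨R, hR⟩ := hB.exists_norm_le
  obtain ⟨N, hN⟩ := exists_nat_gt R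
  refine ⟨Finset.Icc (-(N : ℤ) - 1) N, fun n hn => disjoint_left.2 fun x hx hxn => hn ?_⟩
  have h1 := abs_le.1 (hR x hx)
  have h2 : (n : ℝ) < N := by linarith [hxn.1]
  have h3 : (-(N : ℤ) - 1 : ℝ) < n := by push_cast; linarith [hxn.2]
  rw [Finset.mem_Icc]
  constructor
  · exact_mod_cast h3.le
  · exact_mod_cast h2.le

theorem posPart_lt_top {B : Set ℝ} (hB : MeasurableSet B) (hb : Bornology.IsBounded B) :
    μ.posPart B < ⊤ := by
  obtain ⟨F, hF⟩ := exists_finset_disjoint hb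
  rw [posPart, Measure.sum_apply _ hB,
    tsum_eq_sum (s := F) fun n hn => (μ.piece_jordan_eq_zero n hB (hF n hn)).1]
  exact ENNReal.sum_lt_top.2 fun n _ => measure_lt_top _ _

theorem negPart_lt_top {B : Set ℝ} (hB : MeasurableSet B) (hb : Bornology.IsBounded B) :
    μ.negPart B < ⊤ := by
  obtain ⟨F, hF⟩ := exists_finset_disjoint hb
  rw [negPart, Measure.sum_apply _ hB,
    tsum_eq_sum (s := F) fun n hn => (μ.piece_jordan_eq_zero n hB (hF n hn)).2]
  exact ENNReal.sum_lt_top.2 fun n _ => measure_lt_top _ _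

theorem hasSum_toFun_inter_Ioc {B : Set ℝ} (hB : MeasurableSet B) (hb : Bornology.IsBounded B) :
    HasSum (fun n : ℤ => μ.toFun (B ∩ Ioc (n : ℝ) (n + 1))) (μ.toFun B) := by
  have hd : Pairwise (Function.onFun Disjoint fun n : ℤ => Ioc (n : ℝ) (n + 1)) :=
    pairwise_disjoint_Ioc_intCast ℝ
  have e := Equiv.intEquivNat.symm
  have h := μ.hasSum_iUnion (closure B) hb.isCompact_closure
    (fun i => B ∩ Ioc ((e i : ℤ) : ℝ) ((e i : ℤ) + 1)) (fun i => hB.inter measurableSet_Ioc)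
    (fun i => inter_subset_left.trans subset_closure)
    (fun i j hij => (hd (e.injective.ne hij)).mono inter_subset_right inter_subset_right)
  have hU : ⋃ i : ℕ, B ∩ Ioc ((e i : ℤ) : ℝ) ((e i : ℤ) + 1) = B := by
    rw [e.surjective.iUnion_comp fun n : ℤ => B ∩ Ioc (n : ℝ) (n + 1), ← inter_iUnion,
      iUnion_Ioc_intCast, inter_univ]
  rw [hU] at h
  exact (e.hasSum_iff (f := fun n : ℤ => μ.toFun (B ∩ Ioc (n : ℝ) (n + 1)))).1 h

theorem toFun_eq {B : Set ℝ} (hB : MeasurableSet B) (hb : Bornology.IsBounded B) :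
    μ.toFun B = (μ.posPart B).toReal - (μ.negPart B).toReal := by
  have hp : HasSum (fun n : ℤ => ((μ.piece n).toJordanDecomposition.posPart B).toReal)
      (μ.posPart B).toReal := by
    have := μ.posPart_lt_top hB hb
    rw [posPart, Measure.sum_apply _ hB] at this ⊢
    rw [ENNReal.tsum_toReal_eq fun n => measure_ne_top _ _]
    exact ENNReal.hasSum_toReal this.ne
  have hn : HasSum (fun n : ℤ => ((μ.piece n).toJordanDecomposition.negPart B).toReal)
      (μ.negPart B).toReal := by
    have := μ.negPart_lt_top hB hb
    rw [negPart, Measure.sum_apply _ hB] at this ⊢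
    rw [ENNReal.tsum_toReal_eq fun n => measure_ne_top _ _]
    exact ENNReal.hasSum_toReal this.ne
  refine (μ.hasSum_toFun_inter_Ioc hB hb).unique ((hp.sub hn).congr_fun ?_)
  intro n
  rw [← μ.piece_apply n hB, SignedMeasure.apply_eq_posPart_real_sub_negPart_real _ hB]
  rfl

theorem ext_of_posPart_add_negPart_eq {μ ν : LocBddMeasure}
    (h : μ.posPart + ν.negPart = μ.negPart + ν.posPart) : μ = ν := by
  have hf : μ.toFun = ν.toFun := by
    ext B
    by_cases hB : MeasurableSet B ∧ Bornology.IsBounded B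
    · rw [μ.toFun_eq hB.1 hB.2, ν.toFun_eq hB.1 hB.2]
      have h1 := congrArg (fun m : Measure ℝ => (m B).toReal) h
      simp only [Measure.add_apply] at h1
      rw [ENNReal.toReal_add (μ.posPart_lt_top hB.1 hB.2).ne (ν.negPart_lt_top hB.1 hB.2).ne,
        ENNReal.toReal_add (μ.negPart_lt_top hB.1 hB.2).ne (ν.posPart_lt_top hB.1 hB.2).ne] at h1
      linarith
    · rw [μ.eq_zero_of_not B hB, ν.eq_zero_of_not B hB]
  cases μ; cases ν; cases hf; rfl

/-- Transfers measurability in time from the values of μ and |μ|, where it is assumed, to the Jordan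
parts. -/
theorem toReal_posPart {B : Set ℝ} (hB : MeasurableSet B) (hb : Bornology.IsBounded B) :
    (μ.posPart B).toReal = ((μ.totalVariation B).toReal + μ.toFun B) / 2 := by
  rw [μ.toFun_eq hB hb, totalVariation, Measure.add_apply,
    ENNReal.toReal_add (μ.posPart_lt_top hB hb).ne (μ.negPart_lt_top hB hb).ne]
  ring

theorem toReal_negPart {B : Set ℝ} (hB : MeasurableSet B) (hb : Bornology.IsBounded B) :
    (μ.negPart B).toReal = ((μ.totalVariation B).toReal - μ.toFun B) / 2 := by
  rw [μ.toFun_eq hB hb, totalVariation, Measure.add_apply,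
    ENNReal.toReal_add (μ.posPart_lt_top hB hb).ne (μ.negPart_lt_top hB hb).ne]
  ring

end LocBddMeasure

/-! ### Measurable flows of measures -/

/-- A measurable family of measures on the line which is locally bounded in space and integrable
on bounded time intervals. -/
structure IsMeasureFlow (κ : ℝ → Measure ℝ) : Prop where
  measurable : Measurable κ
  lt_top : ∀ s N : ℝ, κ s (Icc (-N) N) < ⊤
  lintegral_lt_top : ∀ N t : ℝ, ∫⁻ s in Ioc 0 t, κ s (Icc (-N) N) < ⊤

theorem IsMeasureFlow.measurable_coe {κ : ℝ → Measure ℝ} (hκ : IsMeasureFlow κ) {B : Set ℝ}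
    (hB : MeasurableSet B) : Measurable fun s => κ s B :=
  (Measure.measurable_coe hB).comp hκ.measurable

theorem IsMeasureFlow.add {κ η : ℝ → Measure ℝ} (hκ : IsMeasureFlow κ) (hη : IsMeasureFlow η) :
    IsMeasureFlow fun s => κ s + η s where
  measurable := Measure.measurable_of_measurable_coe _ fun B hB => by
    simp only [Measure.add_apply]
    exact (hκ.measurable_coe hB).add (hη.measurable_coe hB)
  lt_top s N := by
    simp only [Measure.add_apply]
    exact ENNReal.add_lt_top.2 ⟨hκ.lt_top s N, hη.lt_top s N⟩
  lintegral_lt_top N t := by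
    simp only [Measure.add_apply]
    rw [lintegral_add_left (hκ.measurable_coe measurableSet_Icc)]
    exact ENNReal.add_lt_top.2 ⟨hκ.lintegral_lt_top N t, hη.lintegral_lt_top N t⟩

theorem iUnion_inter_Icc_nat (B : Set ℝ) : ⋃ n : ℕ, B ∩ Icc (-(n : ℝ)) n = B := by
  rw [← inter_iUnion]
  refine inter_eq_left.2 fun x _ => ?_
  obtain ⟨n, hn⟩ := exists_nat_ge |x|
  exact mem_iUnion.2 ⟨n, abs_le.1 hn⟩

theorem monotone_inter_Icc_nat (B : Set ℝ) : Monotone fun n : ℕ => B ∩ Icc (-(n : ℝ)) n :=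
  fun n m h => by
    have : (n : ℝ) ≤ m := by exact_mod_cast h
    exact inter_subset_inter_right _ (Icc_subset_Icc (by linarith) this)

/-- A family of measures whose values at compact intervals are a.e. measurable on `[0, T]` agrees
a.e. with a measurable family. -/
theorem exists_measureFlow {m : ℝ → Measure ℝ} {T : ℝ} (hfin : ∀ s N : ℝ, m s (Icc (-N) N) < ⊤)
    (hmeas : ∀ q r : ℝ, AEMeasurable (fun s => m s (Icc q r)) (volume.restrict (Icc 0 T)))
    (hint : ∀ N : ℝ, ∫⁻ s in Icc 0 T, m s (Icc (-N) N) < ⊤) :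
    ∃ κ : ℝ → Measure ℝ, IsMeasureFlow κ ∧ ∀ᵐ s ∂(volume.restrict (Icc 0 T)), κ s = m s := by
  have hE : ∀ᵐ s ∂(volume.restrict (Icc 0 T)), ∀ q r : ℚ,
      m s (Icc (q : ℝ) r) = (hmeas q r).mk _ s := by
    rw [ae_all_iff]; intro q; rw [ae_all_iff]; intro r
    exact (hmeas q r).ae_eq_mk
  -- A measurable set of full measure in [0, T] on which all values at rational intervals agree with
  -- their measurable versions. Putting the zero measure at the other times makes the family
  -- measurable, and keeps it integrable on every time interval.
  set D : Set ℝ := (toMeasurable (volume.restrict (Icc 0 T))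
    {s | ¬ ∀ q r : ℚ, m s (Icc (q : ℝ) r) = (hmeas q r).mk _ s})ᶜ ∩ Icc 0 T with hD
  have hDm : MeasurableSet D := (measurableSet_toMeasurable _ _).compl.inter measurableSet_Icc
  have hDae : ∀ᵐ s ∂(volume.restrict (Icc 0 T)), s ∈ D := by
    have h1 : ∀ᵐ s ∂(volume.restrict (Icc 0 T)), s ∈ (toMeasurable (volume.restrict (Icc 0 T))
        {s | ¬ ∀ q r : ℚ, m s (Icc (q : ℝ) r) = (hmeas q r).mk _ s})ᶜ := by
      rw [ae_iff]
      simp only [mem_compl_iff, not_not, ofPred_mem_eq]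
      rw [measure_toMeasurable]
      exact ae_iff.1 hE
    filter_upwards [h1, ae_restrict_mem measurableSet_Icc] with s h1 h2 using ⟨h1, h2⟩
  have hDe : ∀ s ∈ D, ∀ q r : ℚ, m s (Icc (q : ℝ) r) = (hmeas q r).mk _ s := by
    intro s hs
    by_contra hc
    exact hs.1 (subset_toMeasurable _ _ hc)
  set κ : ℝ → Measure ℝ := D.indicator m with hκ
  have hκD : ∀ s ∈ D, κ s = m s := fun s hs => indicator_of_mem hs _
  have hκD' : ∀ s ∉ D, κ s = 0 := fun s hs => indicator_of_notMem hs _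
  have hlt : ∀ s N : ℝ, κ s (Icc (-N) N) < ⊤ := fun s N => by
    by_cases hs : s ∈ D
    · rw [hκD s hs]; exact hfin s N
    · rw [hκD' s hs]; simp
  have hrat : ∀ q r : ℚ, Measurable fun s => κ s (Icc (q : ℝ) r) := by
    intro q r
    have : (fun s => κ s (Icc (q : ℝ) r)) = D.indicator ((hmeas q r).mk _) := by
      ext s
      by_cases hs : s ∈ D
      · rw [hκD s hs, indicator_of_mem hs, hDe s hs]
      · rw [hκD' s hs, indicator_of_notMem hs]; simp
    rw [this]
    exact (hmeas q r).measurable_mk.indicator hDm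
  have hres : ∀ n : ℕ, Measurable fun s => (κ s).restrict (Icc (-(n : ℝ)) n) := by
    intro n
    have : ∀ s, IsFiniteMeasure ((κ s).restrict (Icc (-(n : ℝ)) n)) := fun s =>
      ⟨by rw [Measure.restrict_apply_univ]; exact hlt s n⟩
    have hn := hrat (-n) n
    push_cast at hn
    -- Restricting to [-n, n] makes the measures finite, so measurability propagates from a
    -- π-system; it is the compact intervals with rational endpoints that supply the values on it.
    refine Measurable.measure_of_isPiSystem Real.borel_eq_generateFrom_Iic_rat
      Real.isPiSystem_Iic_rat ?_ ?_
    · rintro _ ⟨_, ⟨q, rfl⟩, rfl⟩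
      have h1 : ∀ s, (κ s).restrict (Icc (-(n : ℝ)) n) (Iic (q : ℝ)) =
          κ s (Icc ((-n : ℚ) : ℝ) ((min q n : ℚ) : ℝ)) := fun s => by
        rw [Measure.restrict_apply measurableSet_Iic]
        congr 1
        ext x
        simp only [mem_inter_iff, mem_Iic, mem_Icc]
        push_cast
        rw [le_min_iff]
        tauto
      simp_rw [h1]
      exact hrat _ _
    · simpa only [Measure.restrict_apply_univ] using hn
  refine ⟨κ, ⟨Measure.measurable_of_measurable_coe _ fun B hB => ?_, hlt, fun N t => ?_⟩, ?_⟩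
  · have h1 : ∀ s, κ s B = ⨆ n : ℕ, (κ s).restrict (Icc (-(n : ℝ)) n) B := fun s => by
      conv_lhs => rw [← iUnion_inter_Icc_nat B, (monotone_inter_Icc_nat B).measure_iUnion]
      simp_rw [Measure.restrict_apply hB]
    simp_rw [h1]
    exact Measurable.iSup fun n => (Measure.measurable_coe hB).comp (hres n)
  · refine lt_of_le_of_lt ((setLIntegral_le_lintegral _ _).trans ?_) (hint N)
    rw [← lintegral_indicator measurableSet_Icc]
    refine lintegral_mono fun s => ?_
    by_cases hs : s ∈ D
    · rw [hκD s hs, indicator_of_mem hs.2]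
    · rw [hκD' s hs]; simp
  · filter_upwards [hDae] with s hs using hκD s hs

theorem IsLocBddFamily.exists_measureFlow {T : ℝ} {μ : ℝ → LocBddMeasure}
    (h : IsLocBddFamily T μ) :
    ∃ P Q : ℝ → Measure ℝ, IsMeasureFlow P ∧ IsMeasureFlow Q ∧
      (∀ᵐ s ∂(volume.restrict (Icc 0 T)), P s = (μ s).posPart) ∧
      ∀ᵐ s ∂(volume.restrict (Icc 0 T)), Q s = (μ s).negPart := by
  have hb : ∀ q r : ℝ, Bornology.IsBounded (Icc q r) := fun q r => Metric.isBounded_Icc q r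
  have hv : ∀ q r : ℝ, AEMeasurable (fun s => ((μ s).totalVariation (Icc q r)).toReal)
      (volume.restrict (Icc 0 T)) := fun q r => (h.integrableOn _ isCompact_Icc).aemeasurable
  have hf : ∀ q r : ℝ, AEMeasurable (fun s => (μ s).toFun (Icc q r))
      (volume.restrict (Icc 0 T)) := fun q r => h.aemeasurable _ measurableSet_Icc (hb q r)
  have hi : ∀ N : ℝ, ∫⁻ s in Icc 0 T, (μ s).totalVariation (Icc (-N) N) < ⊤ := fun N => by
    have h1 := (h.integrableOn (Icc (-N) N) isCompact_Icc).lintegral_lt_top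
    refine lt_of_eq_of_lt (lintegral_congr fun s => (ENNReal.ofReal_toReal ?_).symm) h1
    exact (ENNReal.add_lt_top.2 ⟨(μ s).posPart_lt_top measurableSet_Icc (hb _ _),
      (μ s).negPart_lt_top measurableSet_Icc (hb _ _)⟩).ne
  obtain ⟨P, hP, hP'⟩ := _root_.exists_measureFlow (m := fun s => (μ s).posPart) (T := T)
    (fun s N => (μ s).posPart_lt_top measurableSet_Icc (hb _ _))
    (fun q r => by
      have h1 := (((hv q r).add (hf q r)).div_const 2).ennreal_ofReal
      refine h1.congr (ae_of_all _ fun s => ?_)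
      simp only [Pi.add_apply]
      rw [← (μ s).toReal_posPart measurableSet_Icc (hb q r)]
      exact ENNReal.ofReal_toReal ((μ s).posPart_lt_top measurableSet_Icc (hb _ _)).ne)
    fun N => lt_of_le_of_lt (lintegral_mono fun s =>
      Measure.le_add_right (le_refl (μ s).posPart) (Icc (-N) N)) (hi N)
  obtain ⟨Q, hQ, hQ'⟩ := _root_.exists_measureFlow (m := fun s => (μ s).negPart) (T := T)
    (fun s N => (μ s).negPart_lt_top measurableSet_Icc (hb _ _))
    (fun q r => by
      have h1 := (((hv q r).sub (hf q r)).div_const 2).ennreal_ofReal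
      refine h1.congr (ae_of_all _ fun s => ?_)
      simp only [Pi.sub_apply]
      rw [← (μ s).toReal_negPart measurableSet_Icc (hb q r)]
      exact ENNReal.ofReal_toReal ((μ s).negPart_lt_top measurableSet_Icc (hb _ _)).ne)
    fun N => lt_of_le_of_lt (lintegral_mono fun s =>
      Measure.le_add_left (le_refl (μ s).negPart) (Icc (-N) N)) (hi N)
  exact ⟨P, Q, hP, hQ, hP', hQ'⟩

/-! ### Integrals against a flow and its time primitive -/

/-- Integration against a mixture of measures. -/
theorem integral_bind_measure {α β : Type*} [MeasurableSpace α] [MeasurableSpace β]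
    {m : Measure α} {κ : α → Measure β} (hκ : Measurable κ) {f : β → ℝ} (hf : Measurable f)
    (hi : Integrable f (m.bind κ)) :
    Integrable (fun a => ∫ x, f x ∂κ a) m ∧ ∫ x, f x ∂(m.bind κ) = ∫ a, ∫ x, f x ∂κ a ∂m := by
  have hF : ∀ g : β → ℝ, Measurable g → Integrable g (m.bind κ) →
      Measurable (fun a => ∫⁻ x, ENNReal.ofReal (g x) ∂κ a) ∧
      ∫⁻ a, ∫⁻ x, ENNReal.ofReal (g x) ∂κ a ∂m ≠ ⊤ ∧
      ∫⁻ x, ENNReal.ofReal (g x) ∂(m.bind κ) = ∫⁻ a, ∫⁻ x, ENNReal.ofReal (g x) ∂κ a ∂m := by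
    intro g hg hgi
    have h1 := Measure.lintegral_bind (m := m) hκ.aemeasurable
      (f := fun x => ENNReal.ofReal (g x)) hg.ennreal_ofReal.aemeasurable
    refine ⟨(Measure.measurable_lintegral hg.ennreal_ofReal).comp hκ, ?_, h1⟩
    rw [← h1]
    exact hgi.lintegral_lt_top.ne
  obtain ⟨hp1, hp2, hp3⟩ := hF f hf hi
  obtain ⟨hn1, hn2, hn3⟩ := hF (fun x => -f x) hf.neg hi.neg
  have hpf := ae_lt_top hp1 hp2
  have hnf := ae_lt_top hn1 hn2
  have hae : (fun a => ∫ x, f x ∂κ a) =ᵐ[m] fun a =>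
      (∫⁻ x, ENNReal.ofReal (f x) ∂κ a).toReal - (∫⁻ x, ENNReal.ofReal (-f x) ∂κ a).toReal := by
    filter_upwards [hpf, hnf] with a h1 h2
    have hfi : Integrable f (κ a) := by
      refine ⟨hf.aestronglyMeasurable, ?_⟩
      rw [hasFiniteIntegral_iff_norm]
      calc _ ≤ ∫⁻ x, (ENNReal.ofReal (f x) + ENNReal.ofReal (-f x)) ∂κ a := by
            refine lintegral_mono fun x => ?_
            rw [Real.norm_eq_abs, abs_eq_max_neg, ENNReal.ofReal_max]
            exact max_le le_self_add le_add_self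
        _ < ⊤ := by
            rw [lintegral_add_left hf.ennreal_ofReal]
            exact ENNReal.add_lt_top.2 ⟨h1, h2⟩
    exact integral_eq_lintegral_pos_part_sub_lintegral_neg_part hfi
  have hpi := integrable_toReal_of_lintegral_ne_top hp1.aemeasurable hp2
  have hni := integrable_toReal_of_lintegral_ne_top hn1.aemeasurable hn2
  refine ⟨(hpi.sub hni).congr hae.symm, ?_⟩
  rw [integral_congr_ae hae, integral_sub hpi hni, integral_toReal hp1.aemeasurable hpf,
    integral_toReal hn1.aemeasurable hnf, ← hp3, ← hn3,
    integral_eq_lintegral_pos_part_sub_lintegral_neg_part hi]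

/-- Bounded Borel functions with bounded support. -/
structure IsBddBorel (f : ℝ → ℝ) : Prop where
  measurable : Measurable f
  bound : ∃ M, ∀ x, |f x| ≤ M
  support : ∃ N : ℝ, ∀ x, x ∉ Icc (-N) N → f x = 0

theorem Continuous.isBddBorel {f : ℝ → ℝ} (hf : Continuous f) (hs : HasCompactSupport f) :
    IsBddBorel f where
  measurable := hf.measurable
  bound := hf.bounded_above_of_compact_support hs
  support := by
    obtain ⟨N, hN⟩ := hs.isCompact.isBounded.exists_norm_le
    refine ⟨N, fun x hx => ?_⟩
    by_contra h
    exact hx (abs_le.1 (hN x (subset_tsupport f h)))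

theorem isBddBorel_indicator {B : Set ℝ} (hB : MeasurableSet B) (hb : Bornology.IsBounded B) :
    IsBddBorel (B.indicator 1) where
  measurable := measurable_one.indicator hB
  bound := ⟨1, fun x => by by_cases h : x ∈ B <;> simp [h]⟩
  support := by
    obtain ⟨N, hN⟩ := hb.exists_norm_le
    exact ⟨N, fun x hx => indicator_of_notMem (fun h => hx (abs_le.1 (hN x h))) _⟩

theorem IsBddBorel.integrable {f : ℝ → ℝ} (hf : IsBddBorel f) {m : Measure ℝ}
    (hm : ∀ N : ℝ, m (Icc (-N) N) < ⊤) : Integrable f m := by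
  obtain ⟨M, hM⟩ := hf.bound
  obtain ⟨N, hN⟩ := hf.support
  refine IntegrableOn.integrable_of_forall_notMem_eq_zero (s := Icc (-N) N) ?_ hN
  exact Measure.integrableOn_of_bounded (M := M) (hm N).ne hf.measurable.aestronglyMeasurable
    (ae_of_all _ hM)

namespace IsMeasureFlow

variable {κ : ℝ → Measure ℝ}

/-- The integral over the time interval `(0, t]`. -/
noncomputable def primitive (κ : ℝ → Measure ℝ) (t : ℝ) : Measure ℝ :=
  (volume.restrict (Ioc 0 t)).bind κ

theorem primitive_apply (h : IsMeasureFlow κ) (t : ℝ) {B : Set ℝ} (hB : MeasurableSet B) :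
    primitive κ t B = ∫⁻ s in Ioc 0 t, κ s B :=
  Measure.bind_apply hB h.measurable.aemeasurable

theorem primitive_mono (h : IsMeasureFlow κ) {B : Set ℝ} (hB : MeasurableSet B) :
    Monotone fun t => primitive κ t B := fun s t hst => by
  simp only [h.primitive_apply _ hB]
  exact lintegral_mono_set (Ioc_subset_Ioc_right hst)

theorem isMeasureFlow_primitive (h : IsMeasureFlow κ) : IsMeasureFlow (primitive κ) where
  measurable := Measure.measurable_of_measurable_coe _ fun _ hB => (h.primitive_mono hB).measurable
  lt_top t N := by
    rw [h.primitive_apply t measurableSet_Icc]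
    exact h.lintegral_lt_top N t
  lintegral_lt_top N t := by
    calc _ ≤ ∫⁻ _ in Ioc 0 t, primitive κ t (Icc (-N) N) :=
          setLIntegral_mono measurable_const fun s hs => h.primitive_mono measurableSet_Icc hs.2
      _ < ⊤ := by
        rw [setLIntegral_const, h.primitive_apply t measurableSet_Icc]
        exact ENNReal.mul_lt_top (h.lintegral_lt_top N t) (by simp)

theorem isLocallyFiniteMeasure (h : IsMeasureFlow κ) (t : ℝ) : IsLocallyFiniteMeasure (κ t) :=
  ⟨fun x => ⟨Icc (-(|x| + 1)) (|x| + 1),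
    Icc_mem_nhds (by linarith [neg_abs_le x]) (by linarith [le_abs_self x]), h.lt_top t _⟩⟩

theorem integrable (h : IsMeasureFlow κ) {f : ℝ → ℝ} (hf : IsBddBorel f) (t : ℝ) :
    Integrable f (κ t) := hf.integrable (h.lt_top t)

theorem integral_primitive_aux (h : IsMeasureFlow κ) {f : ℝ → ℝ} (hf : IsBddBorel f) (t : ℝ) :
    IntegrableOn (fun s => ∫ x, f x ∂κ s) (Ioc 0 t) ∧
      ∫ x, f x ∂primitive κ t = ∫ s in Ioc 0 t, ∫ x, f x ∂κ s :=
  integral_bind_measure h.measurable hf.measurable (h.isMeasureFlow_primitive.integrable hf t)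

theorem intervalIntegrable (h : IsMeasureFlow κ) {f : ℝ → ℝ} (hf : IsBddBorel f) {t : ℝ}
    (ht : 0 ≤ t) : IntervalIntegrable (fun s => ∫ x, f x ∂κ s) volume 0 t :=
  (intervalIntegrable_iff_integrableOn_Ioc_of_le ht).2 (h.integral_primitive_aux hf t).1

theorem integral_primitive (h : IsMeasureFlow κ) {f : ℝ → ℝ} (hf : IsBddBorel f) {t : ℝ}
    (ht : 0 ≤ t) : ∫ x, f x ∂primitive κ t = ∫ s in (0 : ℝ)..t, ∫ x, f x ∂κ s := by
  rw [(h.integral_primitive_aux hf t).2, intervalIntegral.integral_of_le ht]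

theorem continuous_integral_primitive (h : IsMeasureFlow κ) {f : ℝ → ℝ} (hf : IsBddBorel f) :
    Continuous fun t => ∫ x, f x ∂primitive κ t := by
  -- For t ≤ 0 the primitive is the zero measure, whereas an oriented integral from 0 to t need not
  -- vanish; cutting the integrand off at 0 gives one formula for all t.
  have h1 : ∀ t, ∫ x, f x ∂primitive κ t =
      ∫ s in (0 : ℝ)..t, (Ioi 0).indicator (fun s => ∫ x, f x ∂κ s) s := by
    intro t
    rw [(h.integral_primitive_aux hf t).2]
    rcases le_total 0 t with ht | ht
    · rw [intervalIntegral.integral_of_le ht]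
      exact setIntegral_congr_fun measurableSet_Ioc fun s hs =>
        (indicator_of_mem (mem_Ioi.2 hs.1) fun s => ∫ x, f x ∂κ s).symm
    · rw [Ioc_eq_empty (not_lt.2 ht), intervalIntegral.integral_of_ge ht]
      have h0 : ∫ s in Ioc t 0, (Ioi 0).indicator (fun s => ∫ x, f x ∂κ s) s = 0 :=
        setIntegral_eq_zero_of_forall_eq_zero fun s hs =>
          indicator_of_notMem (fun h0 => not_lt.2 hs.2 h0) _
      rw [h0]
      simp
  simp_rw [h1]
  have hi : ∀ t, IntegrableOn ((Ioi 0).indicator fun s => ∫ x, f x ∂κ s) (Iic t) := by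
    intro t
    rw [integrableOn_indicator_iff measurableSet_Ioi, Ioi_inter_Iic]
    exact (h.integral_primitive_aux hf t).1
  exact intervalIntegral.continuous_primitive
    (fun a b => ⟨(hi b).mono_set Ioc_subset_Iic_self, (hi a).mono_set Ioc_subset_Iic_self⟩) 0

end IsMeasureFlow

/-! ### Densities of a difference of positive measures -/

theorem isLocallyFiniteMeasure_withDensity_of_bound (m : Measure ℝ) [IsLocallyFiniteMeasure m]
    {g : ℝ → ℝ} (hb : ∀ N : ℝ, ∃ M, ∀ z, |z| ≤ N → |g z| ≤ M) :
    IsLocallyFiniteMeasure (m.withDensity fun z => ENNReal.ofReal (g z)) := by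
  refine ⟨fun x => ⟨Icc (x - 1) (x + 1), Icc_mem_nhds (by linarith) (by linarith), ?_⟩⟩
  obtain ⟨M, hM⟩ := hb (|x| + 1)
  rw [withDensity_apply _ measurableSet_Icc]
  calc _ ≤ ∫⁻ _ in Icc (x - 1) (x + 1), ENNReal.ofReal M ∂m := by
        refine setLIntegral_mono measurable_const fun z hz => ENNReal.ofReal_le_ofReal ?_
        refine (le_abs_self _).trans (hM z (abs_le.2 ⟨?_, ?_⟩))
        · linarith [hz.1, neg_abs_le x]
        · linarith [hz.2, le_abs_self x]
    _ < ⊤ := by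
        rw [setLIntegral_const]
        exact ENNReal.mul_lt_top (by simp) isCompact_Icc.measure_lt_top

theorem integral_withDensity_ofReal (m : Measure ℝ) {g : ℝ → ℝ} (hg : Measurable g) (f : ℝ → ℝ) :
    ∫ z, f z ∂(m.withDensity fun z => ENNReal.ofReal (g z)) = ∫ z, max (g z) 0 * f z ∂m := by
  rw [integral_withDensity_eq_integral_toReal_smul hg.ennreal_ofReal (ae_of_all _ fun _ => by simp)]
  simp only [ENNReal.toReal_ofReal', smul_eq_mul]

theorem isLocallyFiniteMeasure_add (m n : Measure ℝ) [IsLocallyFiniteMeasure m]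
    [IsLocallyFiniteMeasure n] : IsLocallyFiniteMeasure (m + n) :=
  ⟨fun x => ⟨Icc (x - 1) (x + 1), Icc_mem_nhds (by linarith) (by linarith), by
    rw [Measure.add_apply]
    exact ENNReal.add_lt_top.2 ⟨isCompact_Icc.measure_lt_top, isCompact_Icc.measure_lt_top⟩⟩⟩

section Density

variable {P Q : Measure ℝ} {b g : ℝ → ℝ}

/-- The identity b (P - Q) = g dz of signed measures, with the negative terms moved to the other
side. A locally finite measure is determined by its integrals of continuous functions of compact
support. -/
theorem withDensity_add_eq_of_integral [IsLocallyFiniteMeasure P] [IsLocallyFiniteMeasure Q]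
    (hbc : Continuous b) (hb0 : ∀ z, 0 ≤ b z)
    (hg : Measurable g) (hgb : ∀ N : ℝ, ∃ M, ∀ z, |z| ≤ N → |g z| ≤ M)
    (h : ∀ φ : ℝ → ℝ, Continuous φ → HasCompactSupport φ →
      ∫ z, b z * φ z ∂P - ∫ z, b z * φ z ∂Q = ∫ z, φ z * g z) :
    P.withDensity (fun z => ENNReal.ofReal (b z)) +
        volume.withDensity (fun z => ENNReal.ofReal (-g z)) =
      Q.withDensity (fun z => ENNReal.ofReal (b z)) +
        volume.withDensity (fun z => ENNReal.ofReal (g z)) := by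
  have hbb : ∀ N : ℝ, ∃ M, ∀ z, |z| ≤ N → |b z| ≤ M := fun N => by
    obtain ⟨M, hM⟩ := (isCompact_Icc (a := -N) (b := N)).exists_bound_of_continuousOn hbc.continuousOn
    exact ⟨M, fun z hz => hM z (abs_le.1 hz)⟩
  have hngb : ∀ N : ℝ, ∃ M, ∀ z, |z| ≤ N → |-g z| ≤ M := by simpa only [abs_neg] using hgb
  have := isLocallyFiniteMeasure_withDensity_of_bound P hbb
  have := isLocallyFiniteMeasure_withDensity_of_bound Q hbb
  have := isLocallyFiniteMeasure_withDensity_of_bound volume hgb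
  have := isLocallyFiniteMeasure_withDensity_of_bound volume hngb
  have := isLocallyFiniteMeasure_add (P.withDensity fun z => ENNReal.ofReal (b z))
    (volume.withDensity fun z => ENNReal.ofReal (-g z))
  have := isLocallyFiniteMeasure_add (Q.withDensity fun z => ENNReal.ofReal (b z))
    (volume.withDensity fun z => ENNReal.ofReal (g z))
  suffices key : ∀ φ : ℝ → ℝ, Continuous φ → HasCompactSupport φ →
      ∫ z, φ z ∂(P.withDensity (fun z => ENNReal.ofReal (b z)) +
        volume.withDensity (fun z => ENNReal.ofReal (-g z))) =
      ∫ z, φ z ∂(Q.withDensity (fun z => ENNReal.ofReal (b z)) +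
        volume.withDensity (fun z => ENNReal.ofReal (g z))) from
    Measure.ext_of_integral_eq_on_compactlySupported fun φ =>
      key φ φ.continuous φ.hasCompactSupport
  intro φ hφ hs
  have hi : ∀ m : Measure ℝ, IsLocallyFiniteMeasure m → Integrable φ m :=
    fun m _ => hφ.integrable_of_hasCompactSupport hs
  rw [integral_add_measure (hi _ inferInstance) (hi _ inferInstance),
    integral_add_measure (hi _ inferInstance) (hi _ inferInstance),
    integral_withDensity_ofReal _ hbc.measurable, integral_withDensity_ofReal _ hbc.measurable,
    integral_withDensity_ofReal _ hg, integral_withDensity_ofReal (g := fun z => -g z) _ hg.neg]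
  simp only [max_eq_left (hb0 _)]
  have h1 := h φ hφ hs
  have hgi : ∀ g' : ℝ → ℝ, Measurable g' → (∀ N : ℝ, ∃ M, ∀ z, |z| ≤ N → |g' z| ≤ M) →
      Integrable fun z => max (g' z) 0 * φ z := by
    intro g' hg' hgb'
    obtain ⟨M, hM⟩ := hφ.bounded_above_of_compact_support hs
    obtain ⟨N, hN⟩ := hs.isCompact.isBounded.exists_norm_le
    obtain ⟨A, hA⟩ := hgb' N
    refine IsBddBorel.integrable ⟨(hg'.max measurable_const).mul hφ.measurable, ⟨|A| * M, ?_⟩,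
      ⟨N, ?_⟩⟩ fun N => isCompact_Icc.measure_lt_top
    · intro z
      by_cases hz : z ∈ tsupport φ
      · simp only [Pi.mul_apply, abs_mul]
        have h2 : |max (g' z) 0| ≤ A := by
          have := hA z (hN z hz)
          rw [abs_of_nonneg (le_max_right _ _)]
          exact max_le ((le_abs_self _).trans this) ((abs_nonneg _).trans this)
        exact mul_le_mul (h2.trans (le_abs_self A)) (hM z) (abs_nonneg _) (abs_nonneg _)
      · have : 0 ≤ |A| * M := mul_nonneg (abs_nonneg _) ((norm_nonneg _).trans (hM z))
        simpa [image_eq_zero_of_notMem_tsupport hz]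
    · intro z hz
      simp only [Pi.mul_apply]
      rw [image_eq_zero_of_notMem_tsupport fun h => hz (abs_le.1 (hN z h)), mul_zero]
  have h2 : ∫ z, φ z * g z = (∫ z, max (g z) 0 * φ z) - ∫ z, max (-g z) 0 * φ z := by
    rw [← integral_sub (hgi g hg hgb) (hgi (fun z => -g z) hg.neg hngb)]
    refine integral_congr_ae (ae_of_all _ fun z => ?_)
    dsimp only
    rw [← sub_mul, mul_comm]
    congr 1
    rcases le_total 0 (g z) with h | h
    · rw [max_eq_left h, max_eq_right (by linarith)]; ring
    · rw [max_eq_right h, max_eq_left (by linarith)]; ring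
  linarith

/-- Where `b` vanishes, the density vanishes. -/
theorem ae_eq_zero_of_withDensity_add_eq (hbc : Continuous b) (hg : Measurable g)
    (h : P.withDensity (fun z => ENNReal.ofReal (b z)) +
        volume.withDensity (fun z => ENNReal.ofReal (-g z)) =
      Q.withDensity (fun z => ENNReal.ofReal (b z)) +
        volume.withDensity (fun z => ENNReal.ofReal (g z))) :
    ∀ᵐ z, b z = 0 → g z = 0 := by
  have hZ : MeasurableSet {z | b z = 0} := hbc.measurable (measurableSet_singleton 0)
  have hpos : MeasurableSet {z | 0 < g z} := measurableSet_lt measurable_const hg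
  have hneg : MeasurableSet {z | g z < 0} := measurableSet_lt hg measurable_const
  have h0 : ∀ (m : Measure ℝ) (f : ℝ → ℝ) (A : Set ℝ), MeasurableSet A → (∀ z ∈ A, f z ≤ 0) →
      m.withDensity (fun z => ENNReal.ofReal (f z)) A = 0 := by
    intro m f A hA hf
    rw [withDensity_apply _ hA]
    exact setLIntegral_eq_zero hA fun z hz => ENNReal.ofReal_of_nonpos (hf z hz)
  have key : ∀ (f : ℝ → ℝ) (A : Set ℝ), Measurable f → MeasurableSet A → (∀ z ∈ A, 0 < f z) →
      volume.withDensity (fun z => ENNReal.ofReal (f z)) A = 0 → volume A = 0 := by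
    intro f A hf hA hfA hz
    rw [withDensity_apply _ hA, lintegral_eq_zero_iff hf.ennreal_ofReal] at hz
    by_contra hne
    have h1 : ∀ᵐ z ∂volume.restrict A, False := by
      filter_upwards [hz, ae_restrict_mem hA] with z h1 h2
      exact absurd (hfA z h2) (not_lt.2 (ENNReal.ofReal_eq_zero.1 h1))
    rw [Filter.eventually_false_iff_eq_bot, ae_eq_bot, Measure.restrict_eq_zero] at h1
    exact hne h1
  -- On this set three of the four measures in `h` vanish, hence so does the one with density g,
  -- which is strictly positive there.
  have e1 : volume ({z | b z = 0} ∩ {z | 0 < g z}) = 0 := by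
    refine key g _ hg (hZ.inter hpos) (fun z hz => hz.2) ?_
    have h2 := congrArg (fun m : Measure ℝ => m ({z | b z = 0} ∩ {z | 0 < g z})) h
    simp only [Measure.add_apply] at h2
    rw [h0 P b _ (hZ.inter hpos) fun z hz => hz.1.le, h0 Q b _ (hZ.inter hpos) fun z hz => hz.1.le,
      h0 volume (fun z => -g z) _ (hZ.inter hpos) fun z hz => by have := hz.2; simp at this; linarith]
      at h2
    simpa using h2.symm
  have e2 : volume ({z | b z = 0} ∩ {z | g z < 0}) = 0 := by
    refine key (fun z => -g z) _ hg.neg (hZ.inter hneg)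
      (fun z hz => by have := hz.2; simp at this; linarith) ?_
    have h2 := congrArg (fun m : Measure ℝ => m ({z | b z = 0} ∩ {z | g z < 0})) h
    simp only [Measure.add_apply] at h2
    rw [h0 P b _ (hZ.inter hneg) fun z hz => hz.1.le, h0 Q b _ (hZ.inter hneg) fun z hz => hz.1.le,
      h0 volume g _ (hZ.inter hneg) fun z hz => hz.2.le] at h2
    simpa using h2
  filter_upwards [measure_eq_zero_iff_ae_notMem.1 e1, measure_eq_zero_iff_ae_notMem.1 e2]
    with z h1 h2 hbz
  rcases lt_trichotomy (g z) 0 with h3 | h3 | h3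
  · exact absurd ⟨hbz, h3⟩ h2
  · exact h3
  · exact absurd ⟨hbz, h3⟩ h1

/-- Where `b` does not vanish, `P - Q` has the density `g / b`. -/
theorem measure_add_lintegral_div_eq (hbc : Continuous b) (hb0 : ∀ z, 0 ≤ b z) (hg : Measurable g)
    (h : P.withDensity (fun z => ENNReal.ofReal (b z)) +
        volume.withDensity (fun z => ENNReal.ofReal (-g z)) =
      Q.withDensity (fun z => ENNReal.ofReal (b z)) +
        volume.withDensity (fun z => ENNReal.ofReal (g z)))
    {B : Set ℝ} (hB : MeasurableSet B) (hbB : ∀ z ∈ B, b z ≠ 0) :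
    P B + ∫⁻ z in B, ENNReal.ofReal (-(g z / b z)) = Q B + ∫⁻ z in B, ENNReal.ofReal (g z / b z) := by
  have hbm := hbc.measurable
  have hm : Measurable fun z => ENNReal.ofReal ((b z)⁻¹) := hbm.inv.ennreal_ofReal
  have h1 : ∀ m : Measure ℝ,
      ∫⁻ z in B, ENNReal.ofReal ((b z)⁻¹) ∂(m.withDensity fun z => ENNReal.ofReal (b z)) = m B := by
    intro m
    rw [setLIntegral_withDensity_eq_setLIntegral_mul _ hbm.ennreal_ofReal hm hB,
      setLIntegral_congr_fun (g := fun _ => 1) hB, setLIntegral_one]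
    intro z hz
    dsimp only [Pi.mul_apply]
    rw [← ENNReal.ofReal_mul (hb0 z), mul_inv_cancel₀ (hbB z hz), ENNReal.ofReal_one]
  have h2 : ∀ f : ℝ → ℝ, Measurable f →
      ∫⁻ z in B, ENNReal.ofReal ((b z)⁻¹) ∂(volume.withDensity fun z => ENNReal.ofReal (f z)) =
        ∫⁻ z in B, ENNReal.ofReal (f z / b z) := by
    intro f hf
    rw [setLIntegral_withDensity_eq_setLIntegral_mul _ hf.ennreal_ofReal hm hB]
    refine lintegral_congr fun z => ?_
    dsimp only [Pi.mul_apply]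
    rw [← ENNReal.ofReal_mul' (inv_nonneg.2 (hb0 z)), div_eq_mul_inv]
  -- Division by b: both sides are integrated against 1 / b over B, where b does not vanish.
  have h3 := congrArg (fun m : Measure ℝ => ∫⁻ z in B, ENNReal.ofReal ((b z)⁻¹) ∂m) h
  simp only [Measure.restrict_add, lintegral_add_measure] at h3
  rw [h1, h1, h2 _ hg, h2 (fun z => -g z) hg.neg] at h3
  simpa only [neg_div] using h3

/-- The identity for P - Q on the sets {g / b > 0} and {g / b < 0} bounds the positive part of g / b
by P and the negative part by Q. The set Z contributes nothing to the integrals, as g / b is 0 on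
it. -/
theorem integrableOn_div_of_withDensity_add_eq [IsLocallyFiniteMeasure P]
    [IsLocallyFiniteMeasure Q] (hbc : Continuous b) (hb0 : ∀ z, 0 ≤ b z)
    (hg : Measurable g)
    (h : P.withDensity (fun z => ENNReal.ofReal (b z)) +
        volume.withDensity (fun z => ENNReal.ofReal (-g z)) =
      Q.withDensity (fun z => ENNReal.ofReal (b z)) +
        volume.withDensity (fun z => ENNReal.ofReal (g z))) (x y : ℝ) :
    IntegrableOn (fun z => g z / b z) (Ioc x y) ∧
      ∫ z in Ioc x y, |g z / b z| ≤ (P (Ioc x y)).toReal + (Q (Ioc x y)).toReal ∧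
      ∫ z in Ioc x y, g z / b z =
        (P (Ioc x y \ {z | b z = 0})).toReal - (Q (Ioc x y \ {z | b z = 0})).toReal := by
  have hZ : MeasurableSet {z | b z = 0} := hbc.measurable (measurableSet_singleton 0)
  have hf : Measurable fun z => g z / b z := hg.div hbc.measurable
  have hpos : MeasurableSet {z | 0 < g z / b z} := measurableSet_lt measurable_const hf
  have hneg : MeasurableSet {z | 0 < -(g z / b z)} := measurableSet_lt measurable_const hf.neg
  have hPf : ∀ m : Measure ℝ, IsLocallyFiniteMeasure m → m (Ioc x y) < ⊤ :=
    fun m _ => (measure_mono Ioc_subset_Icc_self).trans_lt isCompact_Icc.measure_lt_top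
  have hres : ∀ (f : ℝ → ℝ) (A : Set ℝ), MeasurableSet A → (∀ z ∉ A, f z ≤ 0) →
      ∫⁻ z in Ioc x y, ENNReal.ofReal (f z) = ∫⁻ z in Ioc x y ∩ A, ENNReal.ofReal (f z) := by
    intro f A hA h0
    rw [← lintegral_inter_add_sdiff _ (Ioc x y) hA, setLIntegral_eq_zero (s := Ioc x y \ A)
      (measurableSet_Ioc.diff hA) fun z hz => ENNReal.ofReal_of_nonpos (h0 z hz.2), add_zero]
  have hplus : ∫⁻ z in Ioc x y, ENNReal.ofReal (g z / b z) ≤ P (Ioc x y) := by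
    have h1 := measure_add_lintegral_div_eq hbc hb0 hg h (measurableSet_Ioc.inter hpos)
      (B := Ioc x y ∩ {z | 0 < g z / b z}) fun z hz h0 => by
        have := hz.2; simp [h0] at this
    rw [setLIntegral_eq_zero (measurableSet_Ioc.inter hpos) fun z hz =>
      ENNReal.ofReal_of_nonpos (neg_nonpos.2 (le_of_lt hz.2)), add_zero] at h1
    rw [hres _ _ hpos fun z hz => not_lt.1 hz]
    exact (le_add_self.trans_eq h1.symm).trans (measure_mono inter_subset_left)
  have hminus : ∫⁻ z in Ioc x y, ENNReal.ofReal (-(g z / b z)) ≤ Q (Ioc x y) := by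
    have h1 := measure_add_lintegral_div_eq hbc hb0 hg h (measurableSet_Ioc.inter hneg)
      (B := Ioc x y ∩ {z | 0 < -(g z / b z)}) fun z hz h0 => by
        have := hz.2; simp [h0] at this
    rw [setLIntegral_eq_zero (f := fun z => ENNReal.ofReal (g z / b z))
      (measurableSet_Ioc.inter hneg) fun z hz =>
      ENNReal.ofReal_of_nonpos (neg_pos.1 hz.2).le, add_zero] at h1
    rw [hres (fun z => -(g z / b z)) _ hneg fun z hz => not_lt.1 hz]
    exact (le_add_self.trans_eq h1).trans (measure_mono inter_subset_left)
  have hpt := hplus.trans_lt (hPf P inferInstance)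
  have hmt := hminus.trans_lt (hPf Q inferInstance)
  have habs : ∫⁻ z in Ioc x y, ENNReal.ofReal |g z / b z| =
      (∫⁻ z in Ioc x y, ENNReal.ofReal (g z / b z)) +
        ∫⁻ z in Ioc x y, ENNReal.ofReal (-(g z / b z)) := by
    rw [← lintegral_add_left hf.ennreal_ofReal]
    refine lintegral_congr fun z => ?_
    rcases le_total 0 (g z / b z) with h0 | h0
    · rw [abs_of_nonneg h0, ENNReal.ofReal_of_nonpos (neg_nonpos.2 h0), add_zero]
    · rw [abs_of_nonpos h0, ENNReal.ofReal_of_nonpos h0, zero_add]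
  have hint : IntegrableOn (fun z => g z / b z) (Ioc x y) := by
    refine ⟨hf.aestronglyMeasurable, ?_⟩
    rw [hasFiniteIntegral_iff_norm]
    simp only [Real.norm_eq_abs]
    rw [habs]
    exact ENNReal.add_lt_top.2 ⟨hpt, hmt⟩
  refine ⟨hint, ?_, ?_⟩
  · rw [integral_eq_lintegral_of_nonneg_ae (ae_of_all _ fun _ => abs_nonneg _)
      hint.abs.aestronglyMeasurable, habs, ENNReal.toReal_add hpt.ne hmt.ne]
    exact add_le_add (ENNReal.toReal_mono (hPf P inferInstance).ne hplus)
      (ENNReal.toReal_mono (hPf Q inferInstance).ne hminus)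
  · have h1 := measure_add_lintegral_div_eq hbc hb0 hg h (measurableSet_Ioc.diff hZ)
      (B := Ioc x y \ {z | b z = 0}) fun z hz => hz.2
    have hzero : ∀ z ∉ {z | b z = 0}ᶜ, g z / b z = 0 := fun z hz => by
      have : b z = 0 := not_not.1 hz
      rw [this, div_zero]
    have hd : Ioc x y \ {z | b z = 0} = Ioc x y ∩ {z | b z = 0}ᶜ := rfl
    rw [hd, ← hres (fun z => -(g z / b z)) _ hZ.compl fun z hz => by rw [hzero z hz, neg_zero],
      ← hres (fun z => g z / b z) _ hZ.compl fun z hz => (hzero z hz).le] at h1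
    have h2 := congrArg ENNReal.toReal h1
    have hlt : ∀ m : Measure ℝ, IsLocallyFiniteMeasure m →
        m (Ioc x y ∩ {z | b z = 0}ᶜ) ≠ ⊤ :=
      fun m _ => ((measure_mono inter_subset_left).trans_lt (hPf m inferInstance)).ne
    rw [ENNReal.toReal_add (hlt P inferInstance) hmt.ne,
      ENNReal.toReal_add (hlt Q inferInstance) hpt.ne] at h2
    rw [integral_eq_lintegral_pos_part_sub_lintegral_neg_part hint, hd]
    linarith

end Density

/-! ### Distribution functions and integration by parts -/

/-- The distribution function of a measure, normalized at the origin. -/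
noncomputable def centredCdf (m : Measure ℝ) (z : ℝ) : ℝ := m.real (Ioc 0 z) - m.real (Ioc z 0)

section CentredCdf

variable (m : Measure ℝ) [IsLocallyFiniteMeasure m]

theorem measure_Ioc_ne_top (x y : ℝ) : m (Ioc x y) ≠ ⊤ :=
  ((measure_mono Ioc_subset_Icc_self).trans_lt isCompact_Icc.measure_lt_top).ne

theorem measureReal_Ioc_add {x y z : ℝ} (hxy : x ≤ y) (hyz : y ≤ z) :
    m.real (Ioc x y) + m.real (Ioc y z) = m.real (Ioc x z) := by
  rw [← Ioc_union_Ioc_eq_Ioc hxy hyz, measureReal_union (Ioc_disjoint_Ioc_of_le le_rfl)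
    measurableSet_Ioc (measure_Ioc_ne_top m x y) (measure_Ioc_ne_top m y z)]

theorem centredCdf_sub {x y : ℝ} (hxy : x ≤ y) :
    centredCdf m y - centredCdf m x = m.real (Ioc x y) := by
  unfold centredCdf
  rcases le_total 0 x with hx | hx
  · rw [Ioc_eq_empty (not_lt.2 hx), Ioc_eq_empty (not_lt.2 (hx.trans hxy)),
      ← measureReal_Ioc_add m hx hxy]
    ring
  · rcases le_total 0 y with hy | hy
    · rw [Ioc_eq_empty (not_lt.2 hx), Ioc_eq_empty (not_lt.2 hy), ← measureReal_Ioc_add m hx hy]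
      simp; ring
    · rw [Ioc_eq_empty (not_lt.2 hx), Ioc_eq_empty (not_lt.2 hy), ← measureReal_Ioc_add m hxy hy]
      ring

theorem centredCdf_mono : Monotone (centredCdf m) := fun x y hxy => by
  have := centredCdf_sub m hxy
  have : 0 ≤ m.real (Ioc x y) := measureReal_nonneg
  linarith

theorem abs_centredCdf_le {z N : ℝ} (hz : |z| ≤ N) : |centredCdf m z| ≤ m.real (Icc (-N) N) := by
  have h := abs_le.1 hz
  have hN : 0 ≤ N := (abs_nonneg z).trans hz
  have hm : ∀ x y : ℝ, -N ≤ x → y ≤ N → m.real (Ioc x y) ≤ m.real (Icc (-N) N) :=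
    fun x y hx hy => measureReal_mono (Ioc_subset_Icc_self.trans (Icc_subset_Icc hx hy))
      isCompact_Icc.measure_lt_top.ne
  have h1 := hm 0 z (by linarith) h.2
  have h2 := hm z 0 h.1 hN
  have h3 : 0 ≤ m.real (Ioc 0 z) := measureReal_nonneg
  have h4 : 0 ≤ m.real (Ioc z 0) := measureReal_nonneg
  rw [abs_le]
  unfold centredCdf
  constructor <;> linarith

end CentredCdf

section Primitive

variable {φ : ℝ → ℝ} {N : ℝ}

theorem primitive_eq_zero (hN : ∀ x, N ≤ |x| → φ x = 0) (hN0 : 0 ≤ N)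
    (h0 : ∫ x, φ x = 0) {x : ℝ} (hx : x ∉ Ioc (-N) N) : ∫ r in (-N)..x, φ r = 0 := by
  rcases le_or_gt x (-N) with h | h
  · rw [intervalIntegral.integral_symm, intervalIntegral.integral_of_le h,
      setIntegral_eq_zero_of_forall_eq_zero, neg_zero]
    intro z hz
    exact hN z (by rw [abs_of_nonpos (by linarith [hz.2])]; linarith [hz.2])
  · have hxN : N < x := not_le.1 fun hc => hx ⟨h, hc⟩
    rw [intervalIntegral.integral_eq_integral_of_support_subset, h0]
    intro z hz
    have := not_le.1 fun hc => hz (hN z hc)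
    exact ⟨(abs_lt.1 this).1, (abs_lt.1 this).2.le.trans hxN.le⟩

theorem integral_Ioc_eq_integral (hN : ∀ x, N ≤ |x| → φ x = 0) (f : ℝ → ℝ) :
    ∫ z in Ioc (-N) N, φ z * f z = ∫ z, φ z * f z := by
  refine setIntegral_eq_integral_of_forall_compl_eq_zero fun z hz => ?_
  rw [hN z, zero_mul]
  by_contra hc
  have := abs_lt.1 (not_le.1 hc)
  exact hz ⟨this.1, this.2.le⟩

/-- Integration by parts against the distribution function of a measure. -/
theorem integral_primitive_eq_neg_integral_centredCdf (m : Measure ℝ) [IsLocallyFiniteMeasure m]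
    (hφ : Continuous φ) (hN : ∀ x, N ≤ |x| → φ x = 0) (hN0 : 0 ≤ N) (h0 : ∫ x, φ x = 0) :
    ∫ x, (∫ r in (-N)..x, φ r) ∂m = -∫ z, φ z * centredCdf m z := by
  classical
  have hfin : IsFiniteMeasure (m.restrict (Ioc (-N) N)) :=
    ⟨by rw [Measure.restrict_apply_univ]; exact (measure_Ioc_ne_top m _ _).lt_top⟩
  obtain ⟨M, hM⟩ : ∃ M, ∀ x, ‖φ x‖ ≤ M := by
    refine hφ.bounded_above_of_compact_support (HasCompactSupport.intro
      (isCompact_Icc (a := -N) (b := N)) fun x hx => hN x ?_)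
    by_contra hc
    exact hx (abs_le.1 (not_le.1 hc).le)
  -- Since φ has mean zero, its primitive at x is minus the integral of φ over [x, N], that is minus
  -- the integral of this kernel in z. Fubini then integrates in x first and produces the
  -- distribution function; the constant `centredCdf m (-N)` is killed by the mean-zero condition.
  set k : ℝ × ℝ → ℝ := {p : ℝ × ℝ | p.1 ≤ p.2}.indicator fun p => φ p.2 with hk
  have hset : MeasurableSet {p : ℝ × ℝ | p.1 ≤ p.2} := measurableSet_le measurable_fst measurable_snd
  have hkm : Measurable k := (hφ.measurable.comp measurable_snd).indicator hset
  have hki : Integrable k ((m.restrict (Ioc (-N) N)).prod (volume.restrict (Ioc (-N) N))) := by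
    refine Integrable.of_bound hkm.aestronglyMeasurable M (ae_of_all _ fun p => ?_)
    exact (norm_indicator_le_norm_self _ _).trans (hM _)
  have hu : ∀ x ∈ Ioc (-N) N, ∫ r in (-N)..x, φ r = -∫ z in Ioc (-N) N, k (x, z) := by
    intro x hx
    have h1 : ∫ z in Ioc (-N) N, k (x, z) = ∫ z in x..N, φ z := by
      have : (fun z => k (x, z)) = (Ici x).indicator φ := by
        ext z; by_cases h : x ≤ z <;> simp [hk, h, indicator]
      rw [this, setIntegral_indicator measurableSet_Ici, intervalIntegral.integral_of_le hx.2,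
        ← integral_Icc_eq_integral_Ioc]
      congr 2
      ext z
      simp only [mem_inter_iff, mem_Ioc, mem_Ici, mem_Icc]
      exact ⟨fun h => ⟨h.2, h.1.2⟩, fun h => ⟨⟨hx.1.trans_le h.1, h.2⟩, h.1⟩⟩
    have h2 := intervalIntegral.integral_add_adjacent_intervals (hφ.intervalIntegrable (-N) x)
      (hφ.intervalIntegrable (μ := volume) x N)
    -- The point N itself may lie in the half-open interval, so the vanishing is read off at N + 1
    -- and carried back across (N, N + 1], where φ = 0.
    have h3 := primitive_eq_zero hN hN0 h0 (x := N + 1) (by simp)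
    have h4 : ∫ z in (-N)..N, φ z = 0 := by
      have h5 := intervalIntegral.integral_add_adjacent_intervals (hφ.intervalIntegrable (-N) N)
        (hφ.intervalIntegrable (μ := volume) N (N + 1))
      have h6 : ∫ z in N..(N + 1), φ z = 0 := by
        rw [intervalIntegral.integral_of_le (by linarith)]
        exact setIntegral_eq_zero_of_forall_eq_zero fun z hz =>
          hN z (hz.1.le.trans (le_abs_self z))
      linarith
    rw [h1]; linarith
  have hz : ∀ z ∈ Ioc (-N) N, ∫ x in Ioc (-N) N, k (x, z) ∂m =
      φ z * (centredCdf m z - centredCdf m (-N)) := by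
    intro z hz
    have : (fun x => k (x, z)) = (Iic z).indicator fun _ => φ z := by
      ext x; by_cases h : x ≤ z <;> simp [hk, h, indicator]
    rw [this, setIntegral_indicator measurableSet_Iic, setIntegral_const, centredCdf_sub m hz.1.le,
      smul_eq_mul, mul_comm]
    congr 2
    ext x
    simp only [mem_inter_iff, mem_Ioc, mem_Iic]
    exact ⟨fun h => ⟨h.1.1, h.2⟩, fun h => ⟨⟨h.1, h.2.trans hz.2⟩, h.2⟩⟩
  rw [← setIntegral_eq_integral_of_forall_compl_eq_zero (s := Ioc (-N) N)
    fun x hx => primitive_eq_zero hN hN0 h0 hx, setIntegral_congr_fun measurableSet_Ioc hu,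
    integral_neg, integral_integral_swap (f := fun x z => k (x, z)) hki,
    setIntegral_congr_fun measurableSet_Ioc hz, integral_Ioc_eq_integral hN]
  have hi : Integrable fun z => φ z * centredCdf m z := by
    have hi' : IntegrableOn (fun z => φ z * centredCdf m z) (Icc (-N) N) := by
      refine Measure.integrableOn_of_bounded (M := M * m.real (Icc (-N) N))
        isCompact_Icc.measure_lt_top.ne
        (hφ.measurable.mul (centredCdf_mono m).measurable).aestronglyMeasurable ?_
      refine (ae_restrict_iff' measurableSet_Icc).2 (ae_of_all _ fun z hz => ?_)
      rw [norm_mul]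
      exact mul_le_mul (hM z) (abs_centredCdf_le m (abs_le.2 hz)) (norm_nonneg _)
        ((norm_nonneg _).trans (hM z))
    refine hi'.integrable_of_forall_notMem_eq_zero fun z hz => ?_
    rw [hN z, zero_mul]
    by_contra hc
    exact hz (abs_le.1 (not_le.1 hc).le)
  have hi2 : Integrable φ := hφ.integrable_of_hasCompactSupport (HasCompactSupport.intro
      (isCompact_Icc (a := -N) (b := N)) fun x hx => hN x (by
        by_contra hc
        exact hx (abs_le.1 (not_le.1 hc).le)))
  simp_rw [mul_sub]
  rw [integral_sub hi (hi2.mul_const _), integral_mul_const, h0]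
  ring

end Primitive

theorem isBddBorel_mul {φ g : ℝ → ℝ} (hφ : Continuous φ) (hs : HasCompactSupport φ)
    (hg : Measurable g) (hgb : ∀ N : ℝ, ∃ M, ∀ z, |z| ≤ N → |g z| ≤ M) :
    IsBddBorel fun z => φ z * g z where
  measurable := hφ.measurable.mul hg
  bound := by
    obtain ⟨M, hM⟩ := hφ.bounded_above_of_compact_support hs
    obtain ⟨N, hN⟩ := (hφ.isBddBorel hs).support
    obtain ⟨A, hA⟩ := hgb N
    refine ⟨M * |A|, fun z => ?_⟩
    by_cases hz : z ∈ Icc (-N) N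
    · rw [abs_mul]
      exact mul_le_mul (hM z) ((hA z (abs_le.2 hz)).trans (le_abs_self A)) (abs_nonneg _)
        ((norm_nonneg _).trans (hM z))
    · rw [hN z hz, zero_mul, abs_zero]
      exact mul_nonneg ((norm_nonneg _).trans (hM z)) (abs_nonneg _)
  support := by
    obtain ⟨N, hN⟩ := (hφ.isBddBorel hs).support
    exact ⟨N, fun z hz => by rw [hN z hz, zero_mul]⟩

theorem isBddBorel_mul_centredCdf {φ : ℝ → ℝ} (hφ : Continuous φ) (hs : HasCompactSupport φ)
    (m : Measure ℝ) [IsLocallyFiniteMeasure m] : IsBddBorel fun z => φ z * centredCdf m z :=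
  isBddBorel_mul hφ hs (centredCdf_mono m).measurable fun N => ⟨m.real (Icc (-N) N), fun _ hz =>
    abs_centredCdf_le m hz⟩

/-! ### From the weak equation to a density for b σ² -/

open IsMeasureFlow

/-- The difference `p - q` of two flows of measures solves the continuity equation on `[0, T]` with
zero initial data, and does not charge the boundary of the zero set of `b`. -/
structure IsNullSolution (T : ℝ) (b : ℝ → ℝ) (p q : ℝ → Measure ℝ) : Prop where
  flow_left : IsMeasureFlow p
  flow_right : IsMeasureFlow q
  continuous_b : Continuous b
  weak_eq : ∀ u u' : ℝ → ℝ, (∀ x, HasDerivAt u (u' x) x) → Continuous u' → HasCompactSupport u →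
    ∀ᵐ t ∂(volume.restrict (Icc 0 T)), ∫ x, u x ∂p t - ∫ x, u x ∂q t =
      ∫ s in (0 : ℝ)..t, (∫ x, b x * u' x ∂p s - ∫ x, b x * u' x ∂q s)
  null_left : ∀ᵐ t ∂(volume.restrict (Icc 0 T)), p t (frontier {x | b x = 0}) = 0
  null_right : ∀ᵐ t ∂(volume.restrict (Icc 0 T)), q t (frontier {x | b x = 0}) = 0

namespace IsNullSolution

variable {T : ℝ} {b : ℝ → ℝ} {p q : ℝ → Measure ℝ}

/-- The weak equation integrated in time: it holds at almost every time before, and at every time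
after. -/
theorem integral_primitive_sub (h : IsNullSolution T b p q) {u u' : ℝ → ℝ}
    (hd : ∀ x, HasDerivAt u (u' x) x) (hc : Continuous u') (hs : HasCompactSupport u) {t : ℝ}
    (ht : t ∈ Icc 0 T) :
    ∫ x, u x ∂primitive p t - ∫ x, u x ∂primitive q t =
      ∫ x, b x * u' x ∂primitive (primitive p) t - ∫ x, b x * u' x ∂primitive (primitive q) t := by
  have hu : IsBddBorel u := (continuous_iff_continuousAt.2 fun x => (hd x).continuousAt).isBddBorel hs
  have hbu : IsBddBorel fun x => b x * u' x := by
    refine (h.continuous_b.mul hc).isBddBorel ?_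
    have : u' = deriv u := funext fun x => (hd x).deriv.symm
    rw [this]
    exact hs.deriv.mul_left
  have hp := h.flow_left
  have hq := h.flow_right
  have hp' := hp.isMeasureFlow_primitive
  have hq' := hq.isMeasureFlow_primitive
  rw [hp.integral_primitive hu ht.1, hq.integral_primitive hu ht.1,
    hp'.integral_primitive hbu ht.1, hq'.integral_primitive hbu ht.1,
    ← intervalIntegral.integral_sub (hp.intervalIntegrable hu ht.1)
      (hq.intervalIntegrable hu ht.1),
    ← intervalIntegral.integral_sub (hp'.intervalIntegrable hbu ht.1)
      (hq'.intervalIntegrable hbu ht.1)]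
  refine intervalIntegral.integral_congr_ae ?_
  filter_upwards [(ae_restrict_iff' measurableSet_Icc).1 (h.weak_eq u u' hd hc hs)] with s hs hst
  rw [uIoc_of_le ht.1] at hst
  rw [hs ⟨hst.1.le, hst.2.trans ht.2⟩, hp.integral_primitive hbu hst.1.le,
    hq.integral_primitive hbu hst.1.le, intervalIntegral.integral_sub
      (hp.intervalIntegrable hbu hst.1.le) (hq.intervalIntegrable hbu hst.1.le)]

theorem integral_primitive_primitive_of_integral_eq_zero (h : IsNullSolution T b p q) {φ : ℝ → ℝ}
    (hφ : Continuous φ) (hs : HasCompactSupport φ) (h0 : ∫ x, φ x = 0) {t : ℝ} (ht : t ∈ Icc 0 T) :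
    ∫ x, b x * φ x ∂primitive (primitive p) t - ∫ x, b x * φ x ∂primitive (primitive q) t =
      -∫ z, φ z * (centredCdf (primitive p t) z - centredCdf (primitive q t) z) := by
  have hp := h.flow_left.isMeasureFlow_primitive
  have hq := h.flow_right.isMeasureFlow_primitive
  have := hp.isLocallyFiniteMeasure t
  have := hq.isLocallyFiniteMeasure t
  obtain ⟨N', hN'⟩ := hs.isCompact.isBounded.exists_norm_le
  -- The margin 1 makes φ vanish already for |x| = N.
  set N := |N'| + 1
  have hN : ∀ x, N ≤ |x| → φ x = 0 := fun x hx => image_eq_zero_of_notMem_tsupport fun hx' => by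
    have := hN' x hx'
    rw [Real.norm_eq_abs] at this
    have := le_abs_self N'
    simp only [N] at hx
    linarith
  have hN0 : 0 ≤ N := by positivity
  have hd : ∀ x, HasDerivAt (fun x => ∫ r in (-N)..x, φ r) (φ x) x := fun x =>
    (hφ.integral_hasStrictDerivAt (-N) x).hasDerivAt
  have hus : HasCompactSupport fun x => ∫ r in (-N)..x, φ r :=
    HasCompactSupport.intro (isCompact_Icc (a := -N) (b := N)) fun x hx =>
      primitive_eq_zero hN hN0 h0 fun hx' => hx (Ioc_subset_Icc_self hx')
  rw [← h.integral_primitive_sub hd hφ hus ht,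
    integral_primitive_eq_neg_integral_centredCdf _ hφ hN hN0 h0,
    integral_primitive_eq_neg_integral_centredCdf _ hφ hN hN0 h0]
  simp_rw [mul_sub]
  have hv : ∀ N : ℝ, (volume : Measure ℝ) (Icc (-N) N) < ⊤ := fun _ => isCompact_Icc.measure_lt_top
  rw [integral_sub ((isBddBorel_mul_centredCdf hφ hs _).integrable hv)
    ((isBddBorel_mul_centredCdf hφ hs _).integrable hv)]
  ring

/-- A continuous function of compact support with integral `1`. -/
theorem exists_continuous_integral_eq_one :
    ∃ ψ : ℝ → ℝ, Continuous ψ ∧ HasCompactSupport ψ ∧ ∫ x, ψ x = 1 :=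
  ⟨(default : ContDiffBump (0 : ℝ)).normed volume, ContDiffBump.continuous_normed _,
    ContDiffBump.hasCompactSupport_normed _, ContDiffBump.integral_normed _⟩

/-- The density of `b` times the twice integrated flow. -/
noncomputable def fluxDensity (b : ℝ → ℝ) (p q : ℝ → Measure ℝ) (ψ : ℝ → ℝ) (z t : ℝ) : ℝ :=
  (∫ x, b x * ψ x ∂primitive (primitive p) t - ∫ x, b x * ψ x ∂primitive (primitive q) t +
    ((∫ x, ψ x * centredCdf (primitive p t) x) - ∫ x, ψ x * centredCdf (primitive q t) x)) -
    (centredCdf (primitive p t) z - centredCdf (primitive q t) z)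

/-- Mean-zero test functions determine the density of b σ² only up to a function c(t). The function
ψ of integral 1 fixes it: c(t) is the value for which the claim holds with φ = ψ, and a general φ is
a multiple of ψ plus a mean-zero function. -/
theorem integral_mul_fluxDensity (h : IsNullSolution T b p q) {ψ φ : ℝ → ℝ} (hψ : Continuous ψ)
    (hψs : HasCompactSupport ψ) (hψ1 : ∫ x, ψ x = 1) (hφ : Continuous φ)
    (hφs : HasCompactSupport φ) {t : ℝ} (ht : t ∈ Icc 0 T) :
    ∫ x, b x * φ x ∂primitive (primitive p) t - ∫ x, b x * φ x ∂primitive (primitive q) t =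
      ∫ z, φ z * fluxDensity b p q ψ z t := by
  have hp := h.flow_left.isMeasureFlow_primitive
  have hq := h.flow_right.isMeasureFlow_primitive
  have := hp.isLocallyFiniteMeasure t
  have := hq.isLocallyFiniteMeasure t
  have hv : ∀ N : ℝ, (volume : Measure ℝ) (Icc (-N) N) < ⊤ := fun _ => isCompact_Icc.measure_lt_top
  set a := ∫ x, φ x with ha
  have hφi : Integrable φ := (hφ.isBddBorel hφs).integrable hv
  have hψi : Integrable ψ := (hψ.isBddBorel hψs).integrable hv
  have hcφ := fun m : Measure ℝ => fun _ : IsLocallyFiniteMeasure m =>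
    (isBddBorel_mul_centredCdf hφ hφs m).integrable hv
  have hcψ := fun m : Measure ℝ => fun _ : IsLocallyFiniteMeasure m =>
    (isBddBorel_mul_centredCdf hψ hψs m).integrable hv
  have hdφ : Integrable fun z =>
      φ z * centredCdf (primitive p t) z - φ z * centredCdf (primitive q t) z :=
    (hcφ _ inferInstance).sub (hcφ _ inferInstance)
  have hdψ : Integrable fun z =>
      ψ z * centredCdf (primitive p t) z - ψ z * centredCdf (primitive q t) z :=
    (hcψ _ inferInstance).sub (hcψ _ inferInstance)
  have h1 := h.integral_primitive_primitive_of_integral_eq_zero (φ := fun x => φ x - a * ψ x)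
    (hφ.sub (hψ.const_mul a)) (hφs.sub hψs.mul_left) (by
      rw [integral_sub hφi (hψi.const_mul a), integral_const_mul, hψ1, ← ha]; ring) ht
  have hB : ∀ m : Measure ℝ, IsLocallyFiniteMeasure m → ∫ x, b x * (φ x - a * ψ x) ∂m =
      ∫ x, b x * φ x ∂m - a * ∫ x, b x * ψ x ∂m := by
    intro m _
    have e1 : Integrable (fun x => b x * φ x) m :=
      (h.continuous_b.mul hφ).integrable_of_hasCompactSupport hφs.mul_left
    have e2 : Integrable (fun x => b x * ψ x) m :=
      (h.continuous_b.mul hψ).integrable_of_hasCompactSupport hψs.mul_left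
    rw [← integral_const_mul, ← integral_sub e1 (e2.const_mul a)]
    refine integral_congr_ae (ae_of_all _ fun x => ?_)
    dsimp only; ring
  rw [hB _ (hp.isMeasureFlow_primitive.isLocallyFiniteMeasure t),
    hB _ (hq.isMeasureFlow_primitive.isLocallyFiniteMeasure t)] at h1
  have h2 : ∫ z, (φ z - a * ψ z) * (centredCdf (primitive p t) z - centredCdf (primitive q t) z) =
      ((∫ z, φ z * centredCdf (primitive p t) z) - ∫ z, φ z * centredCdf (primitive q t) z) -
      a * ((∫ z, ψ z * centredCdf (primitive p t) z) -
        ∫ z, ψ z * centredCdf (primitive q t) z) := by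
    rw [← integral_sub (hcφ _ inferInstance) (hcφ _ inferInstance),
      ← integral_sub (hcψ _ inferInstance) (hcψ _ inferInstance), ← integral_const_mul,
      ← integral_sub hdφ (hdψ.const_mul a)]
    refine integral_congr_ae (ae_of_all _ fun x => ?_)
    dsimp only; ring
  unfold fluxDensity
  set c := ∫ x, b x * ψ x ∂primitive (primitive p) t - ∫ x, b x * ψ x ∂primitive (primitive q) t +
    ((∫ x, ψ x * centredCdf (primitive p t) x) - ∫ x, ψ x * centredCdf (primitive q t) x) with hc
  have h3 : ∫ z, φ z * (c - (centredCdf (primitive p t) z - centredCdf (primitive q t) z)) =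
      a * c - ((∫ z, φ z * centredCdf (primitive p t) z) -
        ∫ z, φ z * centredCdf (primitive q t) z) := by
    rw [ha, ← integral_mul_const, ← integral_sub (hcφ _ inferInstance) (hcφ _ inferInstance),
      ← integral_sub (hφi.mul_const c) hdφ]
    refine integral_congr_ae (ae_of_all _ fun x => ?_)
    dsimp only; ring
  rw [h3, hc]
  rw [h2] at h1
  linear_combination h1

/-- Nothing moves where b = 0: C¹ functions u that vanish off O and increase to its indicator
satisfy b u' = 0, so their integrals against σ¹ are zero. -/
theorem primitive_open_eq (h : IsNullSolution T b p q) {O : Set ℝ} (hO : IsOpen O)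
    (hOb : Bornology.IsBounded O) (hOZ : ∀ x ∈ O, b x = 0) {t : ℝ} (ht : t ∈ Icc 0 T) :
    primitive p t O = primitive q t O := by
  obtain ⟨f, hfs, hf, hfr⟩ := hO.exists_contDiff_support_eq (n := 1)
  have hf0 : ∀ x, 0 ≤ f x := fun x => (hfr (mem_range_self x)).1
  have hfO : ∀ x ∉ O, f x = 0 := fun x hx => by
    by_contra hc
    exact hx (hfs ▸ hc)
  set u : ℕ → ℝ → ℝ := fun n x => Real.smoothTransition (n * f x) with hu
  have huO : ∀ n, ∀ x ∉ O, u n x = 0 := fun n x hx => by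
    simp only [hu, hfO x hx, mul_zero, Real.smoothTransition.zero]
  have hc1 : ∀ n, ContDiff ℝ 1 (u n) := fun n =>
    Real.smoothTransition.contDiff.comp (contDiff_const.mul hf)
  have hus : ∀ n, HasCompactSupport (u n) := fun n =>
    HasCompactSupport.intro hOb.isCompact_closure fun x hx => huO n x fun hxO =>
      hx (subset_closure hxO)
  have hbu : ∀ n x, b x * deriv (u n) x = 0 := by
    intro n x
    by_cases hx : x ∈ O
    · rw [hOZ x hx, zero_mul]
    -- Off O the nonnegative function `u n` is 0, so it attains its minimum there; this covers the
    -- boundary of O, where b could be nonzero as far as the hypotheses say.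
    · have hmin : IsLocalMin (u n) x := Filter.Eventually.of_forall fun y => by
        rw [huO n x hx]; exact Real.smoothTransition.nonneg _
      rw [hmin.deriv_eq_zero, mul_zero]
  have heq : ∀ n, ∫ x, u n x ∂primitive p t = ∫ x, u n x ∂primitive q t := by
    intro n
    have := h.integral_primitive_sub (u := u n) (u' := deriv (u n))
      (fun x => ((hc1 n).differentiable one_ne_zero x).hasDerivAt) (hc1 n).continuous_deriv_one
      (hus n) ht
    simp only [hbu, integral_zero, sub_zero] at this
    linarith
  have hlim : ∀ m : Measure ℝ, (∀ N : ℝ, m (Icc (-N) N) < ⊤) →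
      Filter.Tendsto (fun n => ∫ x, u n x ∂m) Filter.atTop (nhds (m.real O)) := by
    intro m hm
    rw [← integral_indicator_one hO.measurableSet]
    refine tendsto_integral_of_dominated_convergence (O.indicator 1)
      (fun n => (hc1 n).continuous.aestronglyMeasurable)
      ((isBddBorel_indicator hO.measurableSet hOb).integrable hm)
      (fun n => ae_of_all _ fun x => ?_) (ae_of_all _ fun x => ?_)
    · by_cases hx : x ∈ O
      · rw [indicator_of_mem hx, Real.norm_of_nonneg (Real.smoothTransition.nonneg _)]
        exact Real.smoothTransition.le_one _
      · rw [indicator_of_notMem hx, huO n x hx, norm_zero]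
    · by_cases hx : x ∈ O
      · rw [indicator_of_mem hx]
        have hpos : 0 < f x := lt_of_le_of_ne (hf0 x) (Ne.symm (by rw [← hfs] at hx; exact hx))
        obtain ⟨n₀, hn₀⟩ := exists_nat_gt (1 / f x)
        refine tendsto_const_nhds.congr' ?_
        filter_upwards [Filter.eventually_ge_atTop n₀] with n hn
        refine (Real.smoothTransition.one_of_one_le ?_).symm
        have : (n₀ : ℝ) ≤ n := by exact_mod_cast hn
        rw [div_lt_iff₀ hpos] at hn₀
        nlinarith
      · rw [indicator_of_notMem hx]
        simp only [huO _ x hx, tendsto_const_nhds]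
  have hp := h.flow_left.isMeasureFlow_primitive.lt_top t
  have hq := h.flow_right.isMeasureFlow_primitive.lt_top t
  have hfin : ∀ m : Measure ℝ, (∀ N : ℝ, m (Icc (-N) N) < ⊤) → m O ≠ ⊤ := by
    intro m hm
    obtain ⟨N, hN⟩ := hOb.exists_norm_le
    exact ((measure_mono fun x hx => abs_le.1 (hN x hx)).trans_lt (hm N)).ne
  have := tendsto_nhds_unique (hlim _ hp) (by simpa only [heq] using hlim _ hq)
  exact (ENNReal.toReal_eq_toReal_iff' (hfin _ hp) (hfin _ hq)).1 this

/-- The closed set Z is its interior, where `primitive_open_eq` applies, together with part of its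
frontier, which neither flow charges. -/
theorem primitive_inter_zeros_eq (h : IsNullSolution T b p q) {t : ℝ} (ht : t ∈ Icc 0 T)
    {B : Set ℝ} (hB : MeasurableSet B) :
    primitive p t (B ∩ {x | b x = 0}) = primitive q t (B ∩ {x | b x = 0}) := by
  set Z := {x | b x = 0} with hZ
  have hZc : IsClosed Z := isClosed_eq h.continuous_b continuous_const
  have hp := h.flow_left.isMeasureFlow_primitive.isLocallyFiniteMeasure t
  have hres : (primitive p t).restrict (interior Z) = (primitive q t).restrict (interior Z) := by
    refine Real.measure_ext_Ioo_rat fun x y => ?_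
    rw [Measure.restrict_apply measurableSet_Ioo, Measure.restrict_apply measurableSet_Ioo]
    exact h.primitive_open_eq (isOpen_Ioo.inter isOpen_interior)
      ((Metric.isBounded_Ioo _ _).subset inter_subset_left) (fun z hz => interior_subset (s := Z) hz.2) ht
  have hnull : ∀ κ : ℝ → Measure ℝ, IsMeasureFlow κ →
      (∀ᵐ s ∂(volume.restrict (Icc 0 T)), κ s (frontier Z) = 0) →
      primitive κ t (B ∩ Z) = (primitive κ t).restrict (interior Z) B := by
    intro κ hκ hn
    rw [Measure.restrict_apply hB]
    refine (measure_eq_measure_of_null_sdiff (inter_subset_inter_right _ interior_subset) ?_).symm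
    refine measure_mono_null (t := frontier Z) ?_ ?_
    · rintro z ⟨⟨hzB, hzZ⟩, hz⟩
      exact ⟨subset_closure hzZ, fun hi => hz ⟨hzB, hi⟩⟩
    · rw [hκ.primitive_apply t isClosed_frontier.measurableSet]
      refine (lintegral_eq_zero_iff (hκ.measurable_coe isClosed_frontier.measurableSet)).2 ?_
      exact ae_restrict_of_ae_restrict_of_subset
        (Ioc_subset_Icc_self.trans (Icc_subset_Icc_right ht.2)) hn
  rw [hnull p h.flow_left h.null_left, hnull q h.flow_right h.null_right, hres]

theorem primitive_primitive_inter_zeros_eq (h : IsNullSolution T b p q) {t : ℝ} (ht : t ∈ Icc 0 T)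
    {B : Set ℝ} (hB : MeasurableSet B) :
    primitive (primitive p) t (B ∩ {x | b x = 0}) =
      primitive (primitive q) t (B ∩ {x | b x = 0}) := by
  have hm : MeasurableSet (B ∩ {x | b x = 0}) :=
    hB.inter (h.continuous_b.measurable (measurableSet_singleton 0))
  rw [h.flow_left.isMeasureFlow_primitive.primitive_apply t hm,
    h.flow_right.isMeasureFlow_primitive.primitive_apply t hm]
  exact setLIntegral_congr_fun measurableSet_Ioc fun s hs =>
    h.primitive_inter_zeros_eq ⟨hs.1.le, hs.2.trans ht.2⟩ hB

end IsNullSolution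

/-! ### Continuity and monotonicity in time of the primitives -/

namespace IsMeasureFlow

variable {κ : ℝ → Measure ℝ}

theorem measureReal_primitive (h : IsMeasureFlow κ) {B : Set ℝ} (hB : MeasurableSet B)
    (hb : Bornology.IsBounded B) {t : ℝ} (ht : 0 ≤ t) :
    IntervalIntegrable (fun s => (κ s).real B) volume 0 t ∧
      (primitive κ t).real B = ∫ s in (0 : ℝ)..t, (κ s).real B := by
  have h1 := h.integral_primitive (isBddBorel_indicator hB hb) ht
  have h2 := h.intervalIntegrable (isBddBorel_indicator hB hb) ht
  simp only [integral_indicator_one hB] at h1 h2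
  exact ⟨h2, h1⟩

theorem continuous_measureReal_primitive (h : IsMeasureFlow κ) {B : Set ℝ} (hB : MeasurableSet B)
    (hb : Bornology.IsBounded B) : Continuous fun t => (primitive κ t).real B := by
  simpa only [integral_indicator_one hB] using
    h.continuous_integral_primitive (isBddBorel_indicator hB hb)

theorem measure_ne_top (h : IsMeasureFlow κ) {B : Set ℝ} (hb : Bornology.IsBounded B) (t : ℝ) :
    κ t B ≠ ⊤ := by
  have := h.isLocallyFiniteMeasure t
  exact hb.measure_lt_top.ne

theorem measureReal_primitive_mono (h : IsMeasureFlow κ) {B : Set ℝ} (hB : MeasurableSet B)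
    (hb : Bornology.IsBounded B) : Monotone fun t => (primitive κ t).real B := fun _ t hst =>
  ENNReal.toReal_mono (h.isMeasureFlow_primitive.measure_ne_top hb t) (h.primitive_mono hB hst)

theorem continuous_centredCdf_primitive (h : IsMeasureFlow κ) (z : ℝ) :
    Continuous fun t => centredCdf (primitive κ t) z :=
  (h.continuous_measureReal_primitive measurableSet_Ioc (Metric.isBounded_Ioc _ _)).sub
    (h.continuous_measureReal_primitive measurableSet_Ioc (Metric.isBounded_Ioc _ _))

theorem abs_centredCdf_primitive_le (h : IsMeasureFlow κ) {z N s t : ℝ} (hz : |z| ≤ N)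
    (hst : s ≤ t) : |centredCdf (primitive κ s) z| ≤ (primitive κ t).real (Icc (-N) N) := by
  have := h.isMeasureFlow_primitive.isLocallyFiniteMeasure s
  exact (abs_centredCdf_le _ hz).trans
    (h.measureReal_primitive_mono measurableSet_Icc (Metric.isBounded_Icc _ _) hst)

theorem continuous_integral_mul_centredCdf (h : IsMeasureFlow κ) {ψ : ℝ → ℝ} (hψ : Continuous ψ)
    (hs : HasCompactSupport ψ) :
    Continuous fun t => ∫ z, ψ z * centredCdf (primitive κ t) z := by
  obtain ⟨N, hN⟩ := (hψ.isBddBorel hs).support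
  refine continuous_iff_continuousAt.2 fun t => ?_
  refine continuousAt_of_dominated
    (bound := fun z => |ψ z| * (primitive κ (t + 1)).real (Icc (-N) N)) ?_ ?_ ?_ ?_
  · refine Filter.Eventually.of_forall fun s => ?_
    have := h.isMeasureFlow_primitive.isLocallyFiniteMeasure s
    exact (isBddBorel_mul_centredCdf hψ hs _).measurable.aestronglyMeasurable
  · filter_upwards [Iic_mem_nhds (lt_add_one t)] with s hs
    refine ae_of_all _ fun z => ?_
    by_cases hz : z ∈ Icc (-N) N
    · rw [norm_mul]
      exact mul_le_mul_of_nonneg_left (h.abs_centredCdf_primitive_le (abs_le.2 hz) hs)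
        (abs_nonneg _)
    · simp [hN z hz]
  · exact (hψ.integrable_of_hasCompactSupport hs).abs.mul_const _
  · exact ae_of_all _ fun z => ((h.continuous_centredCdf_primitive z).const_mul _).continuousAt

end IsMeasureFlow

/-! ### The flux density vanishes, and so does the difference -/

open IsMeasureFlow

namespace IsNullSolution

variable {T C : ℝ} {b : ℝ → ℝ} {p q : ℝ → Measure ℝ} {ψ : ℝ → ℝ}

theorem continuous_fluxDensity (h : IsNullSolution T b p q) (hψ : Continuous ψ)
    (hs : HasCompactSupport ψ) (z : ℝ) : Continuous (fluxDensity b p q ψ z) := by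
  have hbψ : IsBddBorel fun x => b x * ψ x := (h.continuous_b.mul hψ).isBddBorel hs.mul_left
  exact (((h.flow_left.isMeasureFlow_primitive.continuous_integral_primitive hbψ).sub
    (h.flow_right.isMeasureFlow_primitive.continuous_integral_primitive hbψ)).add
      ((h.flow_left.continuous_integral_mul_centredCdf hψ hs).sub
        (h.flow_right.continuous_integral_mul_centredCdf hψ hs))).sub
    ((h.flow_left.continuous_centredCdf_primitive z).sub
      (h.flow_right.continuous_centredCdf_primitive z))

theorem measurable_fluxDensity (h : IsNullSolution T b p q) (t : ℝ) :
    Measurable fun z => fluxDensity b p q ψ z t := by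
  have := h.flow_left.isMeasureFlow_primitive.isLocallyFiniteMeasure t
  have := h.flow_right.isMeasureFlow_primitive.isLocallyFiniteMeasure t
  exact measurable_const.sub
    ((centredCdf_mono (primitive p t)).measurable.sub (centredCdf_mono (primitive q t)).measurable)

theorem fluxDensity_sub (h : IsNullSolution T b p q) {x y : ℝ} (hxy : x ≤ y) (t : ℝ) :
    fluxDensity b p q ψ y t - fluxDensity b p q ψ x t =
      -((primitive p t).real (Ioc x y) - (primitive q t).real (Ioc x y)) := by
  have := h.flow_left.isMeasureFlow_primitive.isLocallyFiniteMeasure t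
  have := h.flow_right.isMeasureFlow_primitive.isLocallyFiniteMeasure t
  rw [← centredCdf_sub _ hxy, ← centredCdf_sub _ hxy]
  unfold fluxDensity
  ring

theorem fluxDensity_bound (h : IsNullSolution T b p q) (hψ : Continuous ψ)
    (hs : HasCompactSupport ψ) (N : ℝ) :
    ∃ M, ∀ z, |z| ≤ N → ∀ t ∈ Icc 0 T, |fluxDensity b p q ψ z t| ≤ M := by
  have hc := h.continuous_fluxDensity hψ hs 0
  obtain ⟨M, hM⟩ := (isCompact_Icc (a := 0) (b := T)).exists_bound_of_continuousOn hc.continuousOn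
  refine ⟨M + ((primitive p T).real (Icc (-N) N) + (primitive q T).real (Icc (-N) N)),
    fun z hz t ht => ?_⟩
  have h1 := h.flow_left.abs_centredCdf_primitive_le hz ht.2
  have h2 := h.flow_right.abs_centredCdf_primitive_le hz ht.2
  have h3 := hM t ht
  have h4 : fluxDensity b p q ψ z t = fluxDensity b p q ψ 0 t -
      (centredCdf (primitive p t) z - centredCdf (primitive q t) z) := by
    simp [fluxDensity, centredCdf]
  rw [h4]
  rw [Real.norm_eq_abs] at h3
  exact (abs_sub _ _).trans (add_le_add h3 ((abs_sub _ _).trans (add_le_add h1 h2)))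

/-- The analytic fields come from the density identity at each time, with L¹ bounds uniform in t
because the positive measures grow with t. The equation for Γ needs σ² to be (G / b) dz with no part
on Z, which is where the absence of mass on ∂Z enters. -/
theorem isFluxDensity (h : IsNullSolution T b p q) (hT : 0 < T) (hC : 0 < C)
    (hb : ∀ x, 0 ≤ b x ∧ b x ≤ C + C * |x|) (hψ : Continuous ψ) (hs : HasCompactSupport ψ)
    (hψ1 : ∫ x, ψ x = 1) : IsFluxDensity T C b (fluxDensity b p q ψ) := by
  have hp := h.flow_left.isMeasureFlow_primitive
  have hq := h.flow_right.isMeasureFlow_primitive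
  have hbd := h.fluxDensity_bound hψ hs
  have hden : ∀ t ∈ Icc 0 T,
      (primitive (primitive p) t).withDensity (fun z => ENNReal.ofReal (b z)) +
        volume.withDensity (fun z => ENNReal.ofReal (-fluxDensity b p q ψ z t)) =
      (primitive (primitive q) t).withDensity (fun z => ENNReal.ofReal (b z)) +
        volume.withDensity (fun z => ENNReal.ofReal (fluxDensity b p q ψ z t)) := by
    intro t ht
    have := hp.isMeasureFlow_primitive.isLocallyFiniteMeasure t
    have := hq.isMeasureFlow_primitive.isLocallyFiniteMeasure t
    refine withDensity_add_eq_of_integral h.continuous_b (fun z => (hb z).1)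
      (h.measurable_fluxDensity t) (fun N => ?_)
      fun φ hφ hφs => h.integral_mul_fluxDensity hψ hs hψ1 hφ hφs ht
    obtain ⟨M, hM⟩ := hbd N
    exact ⟨M, fun z hz => hM z hz t ht⟩
  have hdiv : ∀ t ∈ Icc 0 T, ∀ x y, _ := fun t ht x y =>
    have := hp.isMeasureFlow_primitive.isLocallyFiniteMeasure t
    have := hq.isMeasureFlow_primitive.isLocallyFiniteMeasure t
    integrableOn_div_of_withDensity_add_eq h.continuous_b (fun z => (hb z).1)
      (h.measurable_fluxDensity t) (hden t ht) x y
  have hcont := h.continuous_fluxDensity hψ hs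
  refine ⟨hT, hC, h.continuous_b, hb, hcont, h.measurable_fluxDensity, hbd, fun t ht =>
    ae_eq_zero_of_withDensity_add_eq h.continuous_b (h.measurable_fluxDensity t) (hden t ht),
    fun x y => ⟨(primitive (primitive p) T).real (Ioc x y) +
      (primitive (primitive q) T).real (Ioc x y), fun t ht => ⟨(hdiv t ht x y).1,
        (hdiv t ht x y).2.1.trans (add_le_add
          (hp.measureReal_primitive_mono measurableSet_Ioc (Metric.isBounded_Ioc _ _) ht.2)
          (hq.measureReal_primitive_mono measurableSet_Ioc (Metric.isBounded_Ioc _ _) ht.2))⟩⟩,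
    fun t ht x y hxy => ?_⟩
  obtain ⟨hpi, hpe⟩ := hp.measureReal_primitive (B := Ioc x y) measurableSet_Ioc
    (Metric.isBounded_Ioc _ _) ht.1
  obtain ⟨hqi, hqe⟩ := hq.measureReal_primitive (B := Ioc x y) measurableSet_Ioc
    (Metric.isBounded_Ioc _ _) ht.1
  have hZ : MeasurableSet {z | b z = 0} := h.continuous_b.measurable (measurableSet_singleton 0)
  have hsplit : ∀ κ : ℝ → Measure ℝ, IsMeasureFlow κ → (κ t).real (Ioc x y) =
      (κ t).real (Ioc x y ∩ {z | b z = 0}) + (κ t).real (Ioc x y \ {z | b z = 0}) :=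
    fun κ hκ => (measureReal_inter_add_sdiff hZ (hκ.measure_ne_top (Metric.isBounded_Ioc _ _) t)).symm
  have hzero : (primitive (primitive p) t).real (Ioc x y ∩ {z | b z = 0}) =
      (primitive (primitive q) t).real (Ioc x y ∩ {z | b z = 0}) :=
    congrArg ENNReal.toReal (h.primitive_primitive_inter_zeros_eq ht measurableSet_Ioc)
  rw [← intervalIntegral.integral_sub ((hcont y).intervalIntegrable _ _)
    ((hcont x).intervalIntegrable _ _)]
  simp_rw [h.fluxDensity_sub hxy]
  rw [intervalIntegral.integral_neg, intervalIntegral.integral_sub hpi hqi, ← hpe, ← hqe,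
    hsplit _ hp.isMeasureFlow_primitive, hsplit _ hq.isMeasureFlow_primitive, hzero,
    intervalIntegral.integral_of_le hxy, (hdiv t ht x y).2.2]
  simp only [measureReal_def]
  ring

/-- Increments of G in z are, up to sign, the values of σ¹ on intervals, and G = 0. -/
theorem primitive_eq (h : IsNullSolution T b p q) (hT : 0 < T) (hC : 0 < C)
    (hb : ∀ x, 0 ≤ b x ∧ b x ≤ C + C * |x|) {t : ℝ} (ht : t ∈ Icc 0 T) :
    primitive p t = primitive q t := by
  obtain ⟨ψ, hψ, hs, hψ1⟩ := exists_continuous_integral_eq_one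
  have hG := h.isFluxDensity hT hC hb hψ hs hψ1
  have hp := h.flow_left.isMeasureFlow_primitive
  have hq := h.flow_right.isMeasureFlow_primitive
  have := hp.isLocallyFiniteMeasure t
  refine Measure.ext_of_Ioc _ _ fun x y hxy => ?_
  have h1 := h.fluxDensity_sub (ψ := ψ) hxy.le t
  rw [hG.eq_zero_of_mem x ht, hG.eq_zero_of_mem y ht] at h1
  refine (ENNReal.toReal_eq_toReal_iff' (hp.measure_ne_top (Metric.isBounded_Ioc _ _) t)
    (hq.measure_ne_top (Metric.isBounded_Ioc _ _) t)).1 ?_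
  simp only [measureReal_def] at h1
  linarith

theorem ae_eq (h : IsNullSolution T b p q) (hT : 0 < T) (hC : 0 < C)
    (hb : ∀ x, 0 ≤ b x ∧ b x ≤ C + C * |x|) :
    ∀ᵐ t ∂(volume.restrict (Icc 0 T)), p t = q t := by
  have hI : ∀ x y : ℚ, ∀ᵐ t ∂(volume.restrict (Icc 0 T)),
      p t (Ioo (x : ℝ) y) = q t (Ioo (x : ℝ) y) := by
    intro x y
    have hbd : Bornology.IsBounded (Ioo (x : ℝ) y) := Metric.isBounded_Ioo _ _
    have hpi := fun t : ℝ => h.flow_left.measureReal_primitive (t := t) measurableSet_Ioo hbd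
    have hqi := fun t : ℝ => h.flow_right.measureReal_primitive (t := t) measurableSet_Ioo hbd
    rw [ae_restrict_iff' measurableSet_Icc]
    -- At interior times the two time integrals agree on a full neighbourhood, so Lebesgue
    -- differentiation identifies the integrands.
    have h0 : ∀ᵐ t : ℝ, t ≠ 0 ∧ t ≠ T := (Measure.ae_ne _ _).and (Measure.ae_ne _ _)
    filter_upwards [(hpi T hT.le).1.ae_hasDerivAt_integral, (hqi T hT.le).1.ae_hasDerivAt_integral,
      h0] with t hpt hqt hne ht
    rw [uIcc_of_le hT.le] at hpt hqt
    have h0T : (0 : ℝ) ∈ Icc 0 T := ⟨le_rfl, hT.le⟩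
    have hev : (fun r => ∫ s in (0 : ℝ)..r, (p s).real (Ioo (x : ℝ) y)) =ᶠ[nhds t]
        fun r => ∫ s in (0 : ℝ)..r, (q s).real (Ioo (x : ℝ) y) := by
      filter_upwards [Icc_mem_nhds (lt_of_le_of_ne ht.1 hne.1.symm) (lt_of_le_of_ne ht.2 hne.2)]
        with r hr
      rw [← (hpi r hr.1).2, ← (hqi r hr.1).2, h.primitive_eq hT hC hb hr]
    have h1 := (hpt ht 0 h0T).unique ((hqt ht 0 h0T).congr_of_eventuallyEq hev)
    exact (ENNReal.toReal_eq_toReal_iff' (h.flow_left.measure_ne_top hbd t)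
      (h.flow_right.measure_ne_top hbd t)).1 h1
  have hI' : ∀ᵐ t ∂(volume.restrict (Icc 0 T)), ∀ x y : ℚ,
      p t (Ioo (x : ℝ) y) = q t (Ioo (x : ℝ) y) := ae_all_iff.2 fun x => ae_all_iff.2 (hI x)
  filter_upwards [hI'] with t ht
  have := h.flow_left.isLocallyFiniteMeasure t
  exact Real.measure_ext_Ioo_rat ht

end IsNullSolution

/-! ### Uniqueness of solutions -/

theorem ae_eq_of_isSolution {T : ℝ} (hT : 0 < T) {b : ℝ → ℝ} (hb : Continuous b) {C : ℝ}
    (hC : 0 < C) (hbC : ∀ x, 0 ≤ b x ∧ b x ≤ C + C * |x|) {ν : LocBddMeasure}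
    {μ₁ μ₂ : ℝ → LocBddMeasure} (h₁ : IsSolution T b ν μ₁) (h₂ : IsSolution T b ν μ₂)
    (hn₁ : ∀ᵐ t ∂(volume.restrict (Icc 0 T)),
      (μ₁ t).totalVariation (frontier {x | b x = 0}) = 0)
    (hn₂ : ∀ᵐ t ∂(volume.restrict (Icc 0 T)),
      (μ₂ t).totalVariation (frontier {x | b x = 0}) = 0) :
    ∀ᵐ t ∂(volume.restrict (Icc 0 T)), μ₁ t = μ₂ t := by
  obtain ⟨P₁, Q₁, hP₁, hQ₁, hP₁', hQ₁'⟩ := h₁.isLocBddFamily.exists_measureFlow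
  obtain ⟨P₂, Q₂, hP₂, hQ₂, hP₂', hQ₂'⟩ := h₂.isLocBddFamily.exists_measureFlow
  have hsplit : ∀ μ : LocBddMeasure, μ.totalVariation (frontier {x | b x = 0}) = 0 →
      μ.posPart (frontier {x | b x = 0}) = 0 ∧ μ.negPart (frontier {x | b x = 0}) = 0 := by
    intro μ h
    rw [LocBddMeasure.totalVariation, Measure.add_apply, add_eq_zero] at h
    exact h
  have hrep : ∀ f : ℝ → ℝ, ∀ᵐ s ∂(volume.restrict (Icc 0 T)),
      (μ₁ s).integral f = ∫ x, f x ∂P₁ s - ∫ x, f x ∂Q₁ s ∧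
      (μ₂ s).integral f = ∫ x, f x ∂P₂ s - ∫ x, f x ∂Q₂ s := by
    intro f
    filter_upwards [hP₁', hQ₁', hP₂', hQ₂'] with s e1 e2 e3 e4
    rw [e1, e2, e3, e4]
    exact ⟨rfl, rfl⟩
  have hadd : ∀ f : ℝ → ℝ, IsBddBorel f → ∀ s,
      ∫ x, f x ∂(P₁ s + Q₂ s) - ∫ x, f x ∂(Q₁ s + P₂ s) =
        (∫ x, f x ∂P₁ s - ∫ x, f x ∂Q₁ s) - (∫ x, f x ∂P₂ s - ∫ x, f x ∂Q₂ s) := by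
    intro f hf s
    rw [integral_add_measure (hP₁.integrable hf s) (hQ₂.integrable hf s),
      integral_add_measure (hQ₁.integrable hf s) (hP₂.integrable hf s)]
    ring
  -- The difference of the solutions is (P₁ + Q₂) - (Q₁ + P₂); the terms with ν cancel.
  have hnull : IsNullSolution T b (fun s => P₁ s + Q₂ s) (fun s => Q₁ s + P₂ s) := by
    refine ⟨hP₁.add hQ₂, hQ₁.add hP₂, hb, fun u u' hd hc hs => ?_, ?_, ?_⟩
    · have huc : Continuous u := continuous_iff_continuousAt.2 fun x => (hd x).continuousAt
      have hu's : HasCompactSupport u' := by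
        rw [show u' = deriv u from funext fun x => (hd x).deriv.symm]
        exact hs.deriv
      have hbu : IsBddBorel fun x => b x * u' x := (hb.mul hc).isBddBorel hu's.mul_left
      obtain ⟨N, hN⟩ := (huc.isBddBorel hs).support
      -- Test functions that do not depend on time suffice.
      have htest : IsTestFunction T (fun x _ => u x) (fun _ _ => 0) fun x _ => u' x :=
        { continuousOn := (huc.comp continuous_fst).continuousOn
          continuousOn_ut := continuousOn_const
          continuousOn_ux := (hc.comp continuous_fst).continuousOn
          hasDerivWithinAt_ut := fun x t _ => hasDerivWithinAt_const _ _ _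
          hasDerivAt_ux := fun x _ _ => hd x
          eq_zero := ⟨N, fun x hx _ _ => hN x fun h => not_lt.2 (abs_le.2 h) hx⟩ }
      have hw := (ae_restrict_iff' measurableSet_Icc).1 (hrep fun x => 0 + b x * u' x)
      filter_upwards [h₁.weak_eq _ _ _ htest, h₂.weak_eq _ _ _ htest, hrep u,
        ae_restrict_mem measurableSet_Icc] with t e1 e2 e3 ht
      have hw' : ∀ᵐ s, s ∈ uIoc 0 t →
          (μ₁ s).integral (fun x => 0 + b x * u' x) =
            ∫ x, b x * u' x ∂P₁ s - ∫ x, b x * u' x ∂Q₁ s ∧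
          (μ₂ s).integral (fun x => 0 + b x * u' x) =
            ∫ x, b x * u' x ∂P₂ s - ∫ x, b x * u' x ∂Q₂ s := by
        filter_upwards [hw] with s hs hst
        rw [uIoc_of_le ht.1] at hst
        simpa only [zero_add] using hs ⟨hst.1.le, hst.2.trans ht.2⟩
      rw [intervalIntegral.integral_congr_ae (hw'.mono fun s hs hst => (hs hst).1)] at e1
      rw [intervalIntegral.integral_congr_ae (hw'.mono fun s hs hst => (hs hst).2)] at e2
      simp_rw [hadd _ hbu]
      rw [hadd _ (huc.isBddBorel hs), ← e3.1, ← e3.2, intervalIntegral.integral_sub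
        ((hP₁.intervalIntegrable hbu ht.1).sub (hQ₁.intervalIntegrable hbu ht.1))
        ((hP₂.intervalIntegrable hbu ht.1).sub (hQ₂.intervalIntegrable hbu ht.1))]
      linarith
    · filter_upwards [hP₁', hQ₂', hn₁, hn₂] with s e1 e2 e3 e4
      rw [Measure.add_apply, e1, e2, (hsplit _ e3).1, (hsplit _ e4).2, add_zero]
    · filter_upwards [hQ₁', hP₂', hn₁, hn₂] with s e1 e2 e3 e4
      rw [Measure.add_apply, e1, e2, (hsplit _ e3).2, (hsplit _ e4).1, add_zero]
  filter_upwards [hnull.ae_eq hT hC hbC, hP₁', hQ₁', hP₂', hQ₂'] with t ht e1 e2 e3 e4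
  refine LocBddMeasure.ext_of_posPart_add_negPart_eq ?_
  rw [← e1, ← e2, ← e3, ← e4]
  exact ht

theorem corollary1 (T : ℝ) (hT : 0 < T) (b : ℝ → ℝ) (hb : Continuous b)
    (C : ℝ) (hC : 0 < C) (hbC : ∀ x, 0 ≤ b x ∧ b x ≤ C + C * |x|) (ν : LocBddMeasure) :
    (∀ μ₁ μ₂ : ℝ → LocBddMeasure, IsSolution T b ν μ₁ → IsSolution T b ν μ₂ →
      (∀ᵐ t ∂(volume.restrict (Icc 0 T)),
        (μ₁ t).totalVariation (frontier {x | b x = 0}) = 0) →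
      (∀ᵐ t ∂(volume.restrict (Icc 0 T)),
        (μ₂ t).totalVariation (frontier {x | b x = 0}) = 0) →
      ∀ᵐ t ∂(volume.restrict (Icc 0 T)), μ₁ t = μ₂ t) ∧
    (volume {x | b x = 0} = 0 →
      ∀ μ₁ μ₂ : ℝ → LocBddMeasure, IsSolution T b ν μ₁ → IsSolution T b ν μ₂ →
      (∀ᵐ t ∂(volume.restrict (Icc 0 T)), (μ₁ t).totalVariation ≪ volume) →
      (∀ᵐ t ∂(volume.restrict (Icc 0 T)), (μ₂ t).totalVariation ≪ volume) →
      ∀ᵐ t ∂(volume.restrict (Icc 0 T)), μ₁ t = μ₂ t) := by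
  refine ⟨fun μ₁ μ₂ h₁ h₂ hn₁ hn₂ => ae_eq_of_isSolution hT hb hC hbC h₁ h₂ hn₁ hn₂,
    fun hZ μ₁ μ₂ h₁ h₂ hac₁ hac₂ => ?_⟩
  have hclosed : IsClosed {x | b x = 0} := isClosed_eq hb continuous_const
  -- Z is closed, so ∂Z lies in Z and is null; absolutely continuous measures do not charge it.
  have hfr : volume (frontier {x | b x = 0}) = 0 := measure_mono_null hclosed.frontier_subset hZ
  exact ae_eq_of_isSolution hT hb hC hbC h₁ h₂ (hac₁.mono fun t ht => ht hfr)
    (hac₂.mono fun t ht => ht hfr)
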